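/- Let $(\zeta_j)_{j\in\mathbb Z}$ be i.i.d. positive random variables with finite mean $\mu$ (their variance may be infinite). Define the environment $\omega=(\omega_k)_{k\in\mathbb Z}$ by $\omega_0=0$ and $\omega_k=\omega_{k-1}+\zeta_k$ for all $k\in\mathbb Z$, and let $P$ be its law. Let $(\xi_i)_{i\ge 1}$ be i.i.d. $\mathbb Z$-valued random variables with density $(p_k)_{k\in\mathbb Z}$ and joint law $Q$, where $p_{-k}=p_k$ for all $k$, $p_{k+1}\le p_k$ for all $k\ge 1$ (no condition is imposed on $p_0$, so the simple symmetric random walk is included), and $0<\sum_k k^2p_k<\infty$. Put $S_0=0$, $S_n=\xi_1+\dots+\xi_n$, $Y_n=\omega_{S_n}$, $\tau(0)=0$ and $\tau(n)=\sum_{k=1}^n|\omega_{S_k}-\omega_{S_{k-1}}|$, and define the continuous-time process $$X(t)=Y_n+\operatorname{sgn}(\xi_{n+1})\,(t-\tau(n))\qquad\text{for } t\in[\tau(n),\tau(n+1)).$$ For fixed $\omega$, let $P_\omega$ be the law of the path $(X(t))_{t\ge0}$ under $Q$ (the quenched law). Let $\mathbb P(G\times F)=\int_F P_\omega(G)\,P(d\omega)$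 be the annealed law on pairs (path, environment), with expectation $\mathbb E$. Set $$\bar m=\sum_{k\in\mathbb Z}|k|\,p_k,\qquad m_2=\lim_{n\to\infty}\frac{E_Q(|S_n|^2)}{n}.$$ Then the limit defining $m_2$ exists, and $$\liminf_{t\to\infty}\frac{\mathbb E\left(X(t)^2\right)}{t}\ \ge\ \frac{\mu}{\bar m}\,m_2 .$$ -/

import Mathlib

open MeasureTheory ProbabilityTheory Filter Topology
open scoped ENNReal NNReal

noncomputable section

namespace LevyEnv

/-! ### The environment -/

/-- The targets `ω = (ω_k)` built from the gaps `ζ = (ζ_k)`: `ω_0 = 0` and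
`ω_k = ω_{k-1} + ζ_k` for every integer `k` (see `targets_zero` and `targets_rec`). -/
def targets (ζ : ℤ → ℝ) (k : ℤ) : ℝ :=
  ∑ j ∈ Finset.Ioc 0 k, ζ j - ∑ j ∈ Finset.Ioc k 0, ζ j

theorem targets_zero (ζ : ℤ → ℝ) : targets ζ 0 = 0 := by simp [targets]

theorem targets_rec (ζ : ℤ → ℝ) (k : ℤ) : targets ζ k = targets ζ (k - 1) + ζ k := by
  unfold targets
  rcases lt_or_ge 0 k with hk | hk
  · have h1 : Finset.Ioc 0 k = insert k (Finset.Ioc 0 (k - 1)) := by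
      ext x; simp only [Finset.mem_Ioc, Finset.mem_insert]; omega
    have h2 : Finset.Ioc k 0 = ∅ := Finset.Ioc_eq_empty (by omega)
    have h3 : Finset.Ioc (k - 1) 0 = ∅ := Finset.Ioc_eq_empty (by omega)
    rw [h1, h2, h3, Finset.sum_insert (by simp)]
    simp [add_comm]
  · have h1 : Finset.Ioc (k - 1) 0 = insert k (Finset.Ioc k 0) := by
      ext x; simp only [Finset.mem_Ioc, Finset.mem_insert]; omega
    have h2 : Finset.Ioc 0 k = ∅ := Finset.Ioc_eq_empty (by omega)
    have h3 : Finset.Ioc 0 (k - 1) = ∅ := Finset.Ioc_eq_empty (by omega)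
    rw [h1, h2, h3, Finset.sum_insert (by simp)]
    simp

/-- The law `P` of the environment `ω`, when the gaps are i.i.d. with law `ν`. -/
def envLaw (ν : Measure ℝ) [IsProbabilityMeasure ν] : Measure (ℤ → ℝ) :=
  (Measure.infinitePi (fun _ : ℤ => ν)).map targets

/-! ### The underlying random walk -/

/-- The law `Q` of the i.i.d. jumps with density `p`; `ξ i` is the jump number `i + 1`. -/
def walkLaw (p : PMF ℤ) : Measure (ℕ → ℤ) :=
  Measure.infinitePi (fun _ : ℕ => p.toMeasure)

instance (p : PMF ℤ) : IsProbabilityMeasure (walkLaw p) := by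
  unfold walkLaw; infer_instance

/-- The underlying walk `S_n`, the sum of the first `n` jumps. -/
def walk (ξ : ℕ → ℤ) (n : ℕ) : ℤ := ∑ i ∈ Finset.range n, ξ i

/-- The mean absolute jump `∑_k |k| p_k`. -/
def meanAbsJump (p : PMF ℤ) : ℝ := ∑' k : ℤ, |(k : ℝ)| * (p k).toReal

/-- `E_Q(|S_n|^q) / n^(q/2)`. -/
def scaledMoment (p : PMF ℤ) (q : ℝ) (n : ℕ) : ℝ≥0∞ :=
  (∫⁻ ξ, ENNReal.ofReal (|(walk ξ n : ℝ)| ^ q) ∂(walkLaw p)) / (n : ℝ≥0∞) ^ (q / 2)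

/-- `m_q`, the limit of `E_Q(|S_n|^q) / n^(q/2)` as `n → ∞`. -/
def limitMoment (p : PMF ℤ) (q : ℝ) : ℝ≥0∞ := limUnder atTop (scaledMoment p q)

/-! ### The continuous-time process -/

/-- The collision time `τ(n) = ∑_{k=1}^n |ω_{S_k} - ω_{S_{k-1}}|`. -/
def collisionTime (ω : ℤ → ℝ) (ξ : ℕ → ℤ) (n : ℕ) : ℝ :=
  ∑ k ∈ Finset.range n, |ω (walk ξ (k + 1)) - ω (walk ξ k)|

/-- The number of collisions `n(t) = max {m | τ(m) ≤ t}` up to time `t`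
(`0` on the null event where there is no maximum). -/
def collisionNumber (ω : ℤ → ℝ) (ξ : ℕ → ℤ) (t : ℝ≥0) : ℕ :=
  sSup {m : ℕ | collisionTime ω ξ m ≤ t}

/-- The position `X(t)`: it equals `Y_n + sgn(ξ_{n+1}) (t - τ(n))`, with `Y_n = ω_{S_n}`, for
`t ∈ [τ(n), τ(n+1))` (see `position_eq`). -/
def position (ω : ℤ → ℝ) (ξ : ℕ → ℤ) (t : ℝ≥0) : ℝ :=
  ω (walk ξ (collisionNumber ω ξ t)) +
    ((ξ (collisionNumber ω ξ t)).sign : ℝ) *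
      ((t : ℝ) - collisionTime ω ξ (collisionNumber ω ξ t))

theorem collisionTime_mono (ω : ℤ → ℝ) (ξ : ℕ → ℤ) : Monotone (collisionTime ω ξ) :=
  monotone_nat_of_le_succ fun n => by
    rw [collisionTime, collisionTime, Finset.sum_range_succ]
    exact le_add_of_nonneg_right (abs_nonneg _)

theorem position_eq (ω : ℤ → ℝ) (ξ : ℕ → ℤ) (t : ℝ≥0) (n : ℕ)
    (h₁ : collisionTime ω ξ n ≤ t) (h₂ : (t : ℝ) < collisionTime ω ξ (n + 1)) :
    position ω ξ t = ω (walk ξ n) + ((ξ n).sign : ℝ) * ((t : ℝ) - collisionTime ω ξ n) := by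
  have hs : {m : ℕ | collisionTime ω ξ m ≤ t} = Set.Iic n := by
    ext m
    simp only [Set.mem_ofPred_eq, Set.mem_Iic]
    refine ⟨fun hm => ?_, fun hm => (collisionTime_mono ω ξ hm).trans h₁⟩
    by_contra hlt
    have := collisionTime_mono ω ξ (show n + 1 ≤ m by omega)
    linarith
  have hn : collisionNumber ω ξ t = n := by
    unfold collisionNumber; rw [hs]; exact csSup_Iic
  simp only [position, hn]

/-! ### Measurability, needed for the quenched law to be a kernel -/

theorem measurable_walk (n : ℕ) : Measurable fun ξ : ℕ → ℤ => walk ξ n := by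
  unfold walk; fun_prop

theorem measurable_eval {α : Type*} [MeasurableSpace α] {w : α → ℤ → ℝ} {k : α → ℤ}
    (hw : Measurable w) (hk : Measurable k) : Measurable fun a => w a (k a) :=
  measurable_from_prod_countable_left (f := fun x : (α × ℤ) => w x.1 x.2)
    (fun j => (measurable_pi_apply j).comp hw) |>.comp (measurable_id.prodMk hk)

theorem measurable_collisionTime (n : ℕ) :
    Measurable fun x : (ℤ → ℝ) × (ℕ → ℤ) => collisionTime x.1 x.2 n := by
  unfold collisionTime
  refine Finset.measurable_sum _ fun k _ => ?_
  have h : ∀ m : ℕ, Measurable fun x : (ℤ → ℝ) × (ℕ → ℤ) => x.1 (walk x.2 m) := fun m =>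
    measurable_eval measurable_fst ((measurable_walk m).comp measurable_snd)
  exact continuous_abs.measurable.comp ((h (k + 1)).sub (h k))

theorem measurable_collisionNumber (t : ℝ≥0) :
    Measurable fun x : (ℤ → ℝ) × (ℕ → ℤ) => collisionNumber x.1 x.2 t := by
  have hm : ∀ m : ℕ, MeasurableSet {x : (ℤ → ℝ) × (ℕ → ℤ) | collisionTime x.1 x.2 m ≤ t} :=
    fun m => measurableSet_le (measurable_collisionTime m) measurable_const
  have hb : ∀ k : ℕ, MeasurableSet
      {x : (ℤ → ℝ) × (ℕ → ℤ) | ∀ m : ℕ, collisionTime x.1 x.2 m ≤ t → m ≤ k} := fun k => by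
    simp only [Set.ofPred_forall]
    refine MeasurableSet.iInter fun m => ?_
    by_cases hmk : m ≤ k
    · simp [hmk]
    · have he : {x : (ℤ → ℝ) × (ℕ → ℤ) | collisionTime x.1 x.2 m ≤ t → m ≤ k} =
          {x | collisionTime x.1 x.2 m ≤ t}ᶜ := by
        ext x; simp [hmk]
      rw [he]
      exact (hm m).compl
  refine measurable_of_Iic fun k => ?_
  have he : (fun x : (ℤ → ℝ) × (ℕ → ℤ) => collisionNumber x.1 x.2 t) ⁻¹' Set.Iic k =
      {x | ∀ m : ℕ, collisionTime x.1 x.2 m ≤ t → m ≤ k} ∪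
      (⋃ N : ℕ, {x | ∀ m : ℕ, collisionTime x.1 x.2 m ≤ t → m ≤ N})ᶜ := by
    ext x
    simp only [Set.mem_preimage, Set.mem_Iic, Set.mem_union, Set.mem_ofPred_eq, Set.mem_compl_iff,
      Set.mem_iUnion, collisionNumber]
    by_cases hB : ∃ N : ℕ, ∀ m : ℕ, collisionTime x.1 x.2 m ≤ t → m ≤ N
    · obtain ⟨N, hN⟩ := hB
      have hbd : BddAbove {m : ℕ | collisionTime x.1 x.2 m ≤ t} := ⟨N, fun m h => hN m h⟩
      refine ⟨fun h => Or.inl fun m h' => (le_csSup hbd h').trans h, ?_⟩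
      rintro (h | h)
      · exact csSup_le' fun m h' => h m h'
      · exact absurd ⟨N, hN⟩ h
    · refine ⟨fun _ => Or.inr hB, fun _ => ?_⟩
      have hbd : ¬ BddAbove {m : ℕ | collisionTime x.1 x.2 m ≤ t} :=
        fun ⟨N, hN⟩ => hB ⟨N, fun m h => hN h⟩
      rw [csSup_of_not_bddAbove hbd]
      simp
  rw [he]
  exact (hb k).union (MeasurableSet.iUnion hb).compl

theorem measurable_position :
    Measurable fun x : (ℤ → ℝ) × (ℕ → ℤ) => position x.1 x.2 := by
  refine measurable_pi_lambda _ fun t => ?_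
  have hN := measurable_collisionNumber t
  have hcomp : ∀ {β : Type} [MeasurableSpace β] (f : (ℤ → ℝ) × (ℕ → ℤ) → ℕ → β),
      (∀ n, Measurable fun x => f x n) →
      Measurable fun x => f x (collisionNumber x.1 x.2 t) := fun f hf =>
    measurable_from_prod_countable_left
      (f := fun y : ((ℤ → ℝ) × (ℕ → ℤ)) × ℕ => f y.1 y.2) hf |>.comp (measurable_id.prodMk hN)
  unfold position
  refine (measurable_eval measurable_fst (hcomp (fun x n => walk x.2 n) fun n =>
    (measurable_walk n).comp measurable_snd)).add (Measurable.mul ?_ ?_)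
  · exact hcomp (fun x n => ((x.2 n).sign : ℝ)) fun n =>
      (measurable_of_countable (fun k : ℤ => (k.sign : ℝ))).comp
        ((measurable_pi_apply n).comp measurable_snd)
  · exact measurable_const.sub
      (hcomp (fun x n => collisionTime x.1 x.2 n) measurable_collisionTime)

/-! ### Quenched and annealed laws -/

/-- The quenched law `P_ω`: the law of the path `t ↦ X(t)` in the environment `ω`, on the space of
paths with the σ-algebra generated by the cylinders, as a kernel in `ω`. -/
def quenchedLaw (p : PMF ℤ) : Kernel (ℤ → ℝ) (ℝ≥0 → ℝ) where
  toFun ω := (walkLaw p).map (position ω)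
  measurable' := by
    refine Measure.measurable_of_measurable_coe _ fun G hG => ?_
    have h : ∀ ω : ℤ → ℝ, (walkLaw p).map (position ω) G = walkLaw p
        (Prod.mk ω ⁻¹' ((fun x : (ℤ → ℝ) × (ℕ → ℤ) => position x.1 x.2) ⁻¹' G)) := fun ω => by
      have hω : Measurable (position ω) :=
        measurable_position.comp (measurable_prodMk_left (x := ω))
      rw [Measure.map_apply hω hG]
      rfl
    simp only [h]
    exact measurable_measure_prodMk_left (measurable_position hG)

instance (p : PMF ℤ) : IsMarkovKernel (quenchedLaw p) :=
  ⟨fun ω => Measure.isProbabilityMeasure_map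
    (measurable_position.comp (measurable_prodMk_left (x := ω))).aemeasurable⟩

/-- The annealed law on paths times environments, characterised by
`ℙ(G × F) = ∫_F P_ω(G) P(dω)` (see `annealedLaw_prod`). -/
def annealedLaw (ν : Measure ℝ) [IsProbabilityMeasure ν] (p : PMF ℤ) :
    Measure ((ℝ≥0 → ℝ) × (ℤ → ℝ)) :=
  ((envLaw ν) ⊗ₘ (quenchedLaw p)).map Prod.swap

theorem measurable_targets : Measurable targets := by
  refine measurable_pi_lambda _ fun k => ?_
  unfold targets
  fun_prop

instance (ν : Measure ℝ) [IsProbabilityMeasure ν] : IsProbabilityMeasure (envLaw ν) :=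
  Measure.isProbabilityMeasure_map measurable_targets.aemeasurable

theorem annealedLaw_prod (ν : Measure ℝ) [IsProbabilityMeasure ν] (p : PMF ℤ)
    {G : Set (ℝ≥0 → ℝ)} {F : Set (ℤ → ℝ)} (hG : MeasurableSet G) (hF : MeasurableSet F) :
    annealedLaw ν p (G ×ˢ F) = ∫⁻ ω in F, quenchedLaw p ω G ∂(envLaw ν) := by
  rw [annealedLaw, Measure.map_apply measurable_swap (hG.prod hF), Set.preimage_swap_prod,
    Measure.compProd_apply_prod hF hG]

end LevyEnv

end

/-!
Split the collision time as `τ(n) = ∑ (ζ_j - μ) + μ ∑_{k ≤ n} |ξ_k|`, where the first sum runs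
over the gaps crossed, with multiplicity. For square integrable gaps its second moment is the
variance of a gap times the expected number of pairs of crossings of a common edge, which is
`o(n²)` because, by the central limit theorem, the walk leaves every bounded set in probability.
Gaps that are merely integrable are approximated in `L¹`. Hence `τ(n) / n → μ m̄` in `L¹`, and
about `t / (μ m̄)` collisions occur before time `t`.

The strong law gives `ω_k ≈ μ k`, and Kolmogorov's inequality keeps the walk within `o(√t)`
between nearby collision numbers, so `X(t) = μ S_{⌈t / (μ m̄)⌉} + o(√t)` in probability. Therefore
`X(t) / √t` converges in law to a centred Gaussian of variance `(μ / m̄) m₂`, and Fatou's lemma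
for convergence in law bounds the second moments from below.
-/

namespace LevyEnv

/-! ### Convergence in law and centred sums -/

theorem lintegral_le_liminf_of_tendstoInDistribution {ι Ω' E : Type*} {Ω : ι → Type*}
    {mΩ : ∀ i, MeasurableSpace (Ω i)} {P : (i : ι) → Measure (Ω i)}
    [∀ i, IsProbabilityMeasure (P i)] {mΩ' : MeasurableSpace Ω'} {P' : Measure Ω'}
    [IsProbabilityMeasure P'] [TopologicalSpace E] [MeasurableSpace E] [OpensMeasurableSpace E]
    {X : (i : ι) → Ω i → E} {Z : Ω' → E} {l : Filter ι} [l.NeBot] {f : E → ℝ≥0}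
    (hf : Continuous f) (h : TendstoInDistribution X l Z P P') :
    ∫⁻ ω, f (Z ω) ∂P' ≤ liminf (fun i => ∫⁻ ω, f (X i ω) ∂P i) l := by
  have hsup (x : E) : (f x : ℝ≥0∞) = ⨆ M : ℕ, ((min (f x) M : ℝ≥0) : ℝ≥0∞) := by
    refine le_antisymm ?_ (iSup_le fun M => ENNReal.coe_le_coe.2 (min_le_left _ _))
    obtain ⟨M, hM⟩ := exists_nat_ge (f x)
    exact le_iSup_of_le M (by simp [hM])
  have htrunc (M : ℕ) :
      Tendsto (fun i => ∫⁻ ω, (min (f (X i ω)) M : ℝ≥0) ∂P i) l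
        (𝓝 (∫⁻ ω, (min (f (Z ω)) M : ℝ≥0) ∂P')) := by
    let g : BoundedContinuousFunction E ℝ≥0 :=
      ⟨⟨fun x => min (f x) M, by fun_prop⟩, M, fun x y =>
        (NNReal.dist_eq _ _).trans_le <| abs_sub_le_of_nonneg_of_le (by positivity)
          (NNReal.coe_le_coe.2 (min_le_right _ _)) (by positivity)
          (NNReal.coe_le_coe.2 (min_le_right _ _))⟩
    have hgm : Measurable fun x => (g x : ℝ≥0∞) := g.continuous.measurable.coe_nnreal_ennreal
    have hg := ProbabilityMeasure.tendsto_iff_forall_lintegral_tendsto.1 h.tendsto g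
    simp only [ProbabilityMeasure.coe_mk] at hg
    rw [lintegral_map' hgm.aemeasurable h.aemeasurable_limit] at hg
    simp_rw [fun i => lintegral_map' hgm.aemeasurable (h.forall_aemeasurable i)] at hg
    exact hg
  have hmeas (M : ℕ) : AEMeasurable (fun ω => ((min (f (Z ω)) M : ℝ≥0) : ℝ≥0∞)) P' :=
    ((hf.measurable.comp_aemeasurable h.aemeasurable_limit).min
      aemeasurable_const).coe_nnreal_ennreal
  calc ∫⁻ ω, f (Z ω) ∂P' = ⨆ M : ℕ, ∫⁻ ω, (min (f (Z ω)) M : ℝ≥0) ∂P' := by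
        simp_rw [hsup]
        exact lintegral_iSup' hmeas (ae_of_all _ fun ω M N hMN =>
          ENNReal.coe_le_coe.2 (min_le_min_left _ (Nat.cast_le.2 hMN)))
    _ ≤ liminf (fun i => ∫⁻ ω, f (X i ω) ∂P i) l := iSup_le fun M => by
        rw [← (htrunc M).liminf_eq]
        exact liminf_le_liminf (Eventually.of_forall fun i => lintegral_mono fun ω =>
          ENNReal.coe_le_coe.2 (min_le_left _ _))

theorem submartingale_comp_of_convexOn {Ω E ι : Type*} [Preorder ι] {m0 : MeasurableSpace Ω}
    {P : Measure Ω} [IsFiniteMeasure P] {ℱ : Filtration ι m0} [NormedAddCommGroup E]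
    [NormedSpace ℝ E] [CompleteSpace E] {M : ι → Ω → E} {φ : E → ℝ} (hM : Martingale M ℱ P)
    (hφ : ConvexOn ℝ Set.univ φ) (hφc : Continuous φ) (hint : ∀ i, Integrable (φ ∘ M i) P) :
    Submartingale (fun i => φ ∘ M i) ℱ P := by
  refine ⟨fun i => hφc.comp_stronglyMeasurable (hM.1 i), fun i j hij => ?_, hint⟩
  filter_upwards [hφ.map_condExp_le_univ (ℱ.le i) hφc.lowerSemicontinuous (hM.integrable j)
    (hint j), hM.condExp_ae_eq hij] with ω hle heq
  rwa [Function.comp_apply, heq] at hle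

section CentredSums

variable {Ω : Type*} [MeasurableSpace Ω] {P : Measure Ω} {X : ℕ → Ω → ℝ} {v : ℝ}

theorem integral_sum_range_sq (hi : iIndepFun X P) (hL : ∀ i, MemLp (X i) 2 P)
    (h0 : ∀ i, P[X i] = 0) (hv : ∀ i, Var[X i; P] = v) (n : ℕ) :
    ∫ ω, (∑ i ∈ Finset.range n, X i ω) ^ 2 ∂P = n * v := by
  have := hi.isProbabilityMeasure
  have hmean : ∫ ω, (∑ i ∈ Finset.range n, X i) ω ∂P = 0 := by
    simp_rw [Finset.sum_apply]
    rw [integral_finsetSum _ fun i _ => (hL i).integrable one_le_two]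
    simp [h0]
  have hvar := IndepFun.variance_sum (s := Finset.range n) (fun i _ => hL i)
    fun i _ j _ hij => hi.indepFun hij
  rw [variance_of_integral_eq_zero (memLp_finsetSum' _ fun i _ => hL i).aemeasurable hmean] at hvar
  simpa [hv] using hvar

-- The sums start with `X 0`, so only after the shift by one are they adapted to the natural
-- filtration.
theorem martingale_sum_range_succ (hi : iIndepFun X P) (hm : ∀ i, Measurable (X i))
    (hint : ∀ i, Integrable (X i) P) (h0 : ∀ i, P[X i] = 0) :
    Martingale (fun n ω => ∑ i ∈ Finset.range (n + 1), X i ω)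
      (Filtration.natural X fun i => (hm i).stronglyMeasurable) P := by
  have := hi.isProbabilityMeasure
  have hadp := Filtration.stronglyAdapted_natural (u := X) fun i => (hm i).stronglyMeasurable
  refine martingale_of_condExp_sub_eq_zero_nat (fun n => ?_)
    (fun n => integrable_finsetSum _ fun i _ => hint i) fun n => ?_
  · exact Finset.stronglyMeasurable_fun_sum _ fun i hi =>
      (hadp i).mono (Filtration.mono _ (Finset.mem_range_succ_iff.1 hi))
  · have hstep : ((fun ω => ∑ i ∈ Finset.range (n + 1 + 1), X i ω) -
        fun ω => ∑ i ∈ Finset.range (n + 1), X i ω) = X (n + 1) := by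
      ext ω
      simp [Finset.sum_range_succ _ (n + 1)]
    rw [hstep]
    refine (hi.condExp_natural_ae_eq_of_lt _ n.lt_succ_self).trans ?_
    rw [h0]
    rfl

theorem kolmogorov_maximal_ineq (hi : iIndepFun X P) (hm : ∀ i, Measurable (X i))
    (hL : ∀ i, MemLp (X i) 2 P) (h0 : ∀ i, P[X i] = 0) (hv : ∀ i, Var[X i; P] = v) (n : ℕ)
    {r : ℝ} (hr : 0 < r) :
    P {ω | ∃ k ≤ n, r ≤ |∑ i ∈ Finset.range k, X i ω|} ≤ ENNReal.ofReal (n * v / r ^ 2) := by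
  have := hi.isProbabilityMeasure
  rcases n with _ | n
  · simp [hr.not_ge]
  have hsq_int (n : ℕ) : Integrable (fun ω => (∑ i ∈ Finset.range (n + 1), X i ω) ^ 2) P :=
    (memLp_finsetSum _ fun i _ => hL i).integrable_sq
  have hsub : Submartingale (fun n ω => (∑ i ∈ Finset.range (n + 1), X i ω) ^ 2)
      (Filtration.natural X fun i => (hm i).stronglyMeasurable) P :=
    submartingale_comp_of_convexOn (φ := fun x => x ^ 2)
      (martingale_sum_range_succ hi hm (fun i => (hL i).integrable one_le_two) h0)
      even_two.convexOn_pow (by fun_prop) hsq_int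
  have hdoob := maximal_ineq hsub (fun n ω => sq_nonneg _) (ε := (r ^ 2).toNNReal) n
  have hincl : {ω | ∃ k ≤ n + 1, r ≤ |∑ i ∈ Finset.range k, X i ω|} ⊆
      {ω | ((r ^ 2).toNNReal : ℝ) ≤ (Finset.range (n + 1)).sup' Finset.nonempty_range_add_one
        fun k => (∑ i ∈ Finset.range (k + 1), X i ω) ^ 2} := by
    rintro ω ⟨k, hk, hle⟩
    obtain ⟨k, rfl⟩ : ∃ j, k = j + 1 := Nat.exists_eq_succ_of_ne_zero fun h => by
      simp [h, hr.not_ge] at hle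
    rw [Set.mem_ofPred_eq, Real.coe_toNNReal _ (sq_nonneg r)]
    refine le_trans ?_ (Finset.le_sup' _ (Finset.mem_range.2 (Nat.lt_of_succ_le hk)))
    exact sq_le_sq.2 ((abs_of_pos hr).trans_le hle)
  rw [ENNReal.ofReal_div_of_pos (by positivity), ENNReal.le_div_iff_mul_le (by simp [hr.ne'])
    (by simp), mul_comm, ← integral_sum_range_sq hi hL h0 hv (n + 1)]
  exact (mul_le_mul_right (measure_mono hincl) _).trans <| hdoob.trans <|
    ENNReal.ofReal_le_ofReal <|
      setIntegral_le_integral (hsq_int n) (ae_of_all _ fun ω => sq_nonneg _)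

theorem tendsto_measure_abs_sum_range_le (hi : iIndepFun X P)
    (hident : ∀ i, IdentDistrib (X i) (X 0) P P) (hL : MemLp (X 0) 2 P) (h0 : P[X 0] = 0)
    (hv : Var[X 0; P] ≠ 0) (R : ℝ) :
    Tendsto (fun n => P {ω | |∑ i ∈ Finset.range n, X i ω| ≤ R}) atTop (𝓝 0) := by
  have := hi.isProbabilityMeasure
  set γ := gaussianReal 0 Var[X 0; P].toNNReal
  have hclt : TendstoInDistribution (fun (n : ℕ) ω => (√n)⁻¹ * ∑ i ∈ Finset.range n, X i ω) atTop
      id (fun _ => P) γ := by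
    simpa [h0] using tendstoInDistribution_inv_sqrt_mul_sum_sub (P' := γ) (Y := id)
      HasLaw.id hL hi hident
  have : NullSingletonClass γ := nullSingletonClass_gaussianReal (by
    simpa using (variance_nonneg (X 0) P).lt_of_ne' hv)
  have hball := tendsto_measure_cthickening_of_isClosed (μ := γ) (s := {(0 : ℝ)})
    ⟨1, one_pos, measure_ne_top _ _⟩ isClosed_singleton
  rw [measure_singleton] at hball
  refine ENNReal.tendsto_nhds_zero.2 fun ε hε => ?_
  obtain ⟨δ, hδε, hδ⟩ := (((hball.mono_left nhdsWithin_le_nhds).eventually_lt_const hε).and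
    (self_mem_nhdsWithin (s := Set.Ioi 0))).exists
  have hlimsup := ProbabilityMeasure.limsup_measure_closed_le_of_tendsto hclt.tendsto
    (Metric.isClosed_cthickening (δ := δ) (E := {(0 : ℝ)}))
  simp only [ProbabilityMeasure.coe_mk, Measure.map_id] at hlimsup
  have hsmall : ∀ᶠ n : ℕ in atTop, (√n)⁻¹ * R ≤ δ := by
    have : Tendsto (fun n : ℕ => (√n)⁻¹ * R) atTop (𝓝 (0 * R)) :=
      (Real.tendsto_sqrt_atTop.comp tendsto_natCast_atTop_atTop).inv_tendsto_atTop.mul_const R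
    rw [zero_mul] at this
    exact this.eventually_le_const hδ
  filter_upwards [eventually_lt_of_limsup_lt (hlimsup.trans_lt hδε), hsmall] with n hn hR
  rw [Measure.map_apply_of_aemeasurable (hclt.forall_aemeasurable n)
    Metric.isClosed_cthickening.measurableSet] at hn
  refine (measure_mono fun ω hω => ?_).trans hn.le
  rw [Set.mem_preimage, Metric.cthickening_singleton _ hδ.le, mem_closedBall_zero_iff, norm_mul,
    Real.norm_of_nonneg (by positivity)]
  exact (mul_le_mul_of_nonneg_left hω (by positivity)).trans hR

end CentredSums

/-! ### The jumps of the walk -/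

section Jumps

variable (p : PMF ℤ)

theorem measurePreserving_jump (i : ℕ) :
    MeasurePreserving (fun ξ : ℕ → ℤ => ξ i) (walkLaw p) p.toMeasure :=
  measurePreserving_eval_infinitePi (fun _ : ℕ => p.toMeasure) i

theorem iIndepFun_comp_jump (f : ℤ → ℝ) :
    iIndepFun (fun (i : ℕ) (ξ : ℕ → ℤ) => f (ξ i)) (walkLaw p) :=
  iIndepFun_infinitePi (X := fun (_ : ℕ) (k : ℤ) => f k) fun _ => measurable_of_countable f

theorem identDistrib_comp_jump (f : ℤ → ℝ) (i : ℕ) :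
    IdentDistrib (fun ξ : ℕ → ℤ => f (ξ i)) f (walkLaw p) p.toMeasure :=
  .comp ⟨(measurable_pi_apply i).aemeasurable, aemeasurable_id, by
    rw [(measurePreserving_jump p i).map_eq]; exact Measure.map_id.symm⟩ (measurable_of_countable f)

theorem walk_cast (ξ : ℕ → ℤ) (n : ℕ) : (walk ξ n : ℝ) = ∑ i ∈ Finset.range n, (ξ i : ℝ) := by
  simp [walk]

/-- The variance of a jump of the walk. -/
noncomputable def jumpVariance : ℝ := Var[fun k : ℤ => (k : ℝ); p.toMeasure]

variable {p}

theorem memLp_jump (hp_var : Summable fun k : ℤ => (k : ℝ) ^ 2 * (p k).toReal) :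
    MemLp (fun k : ℤ => (k : ℝ)) 2 p.toMeasure := by
  have hm := (measurable_of_countable fun k : ℤ => (k : ℝ)).aestronglyMeasurable
    (μ := p.toMeasure)
  rw [memLp_two_iff_integrable_sq hm]
  refine ⟨hm.pow 2, ?_⟩
  have hterm (k : ℤ) : ‖(k : ℝ) ^ 2‖ₑ * p.toMeasure {k} =
      ENNReal.ofReal ((k : ℝ) ^ 2 * (p k).toReal) := by
    rw [p.toMeasure_apply_singleton k (measurableSet_singleton k),
      Real.enorm_of_nonneg (sq_nonneg _), ENNReal.ofReal_mul (sq_nonneg _),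
      ENNReal.ofReal_toReal (p.apply_ne_top k)]
  rw [HasFiniteIntegral, lintegral_countable']
  simp only [hterm]
  rw [← ENNReal.ofReal_tsum_of_nonneg (fun k => by positivity) hp_var]
  exact ENNReal.ofReal_lt_top

theorem tsum_mul_apply_eq_zero_of_symm (hp_symm : ∀ k : ℤ, p (-k) = p k) :
    ∑' k : ℤ, (k : ℝ) * (p k).toReal = 0 := by
  have hneg : ∑' k : ℤ, (k : ℝ) * (p k).toReal = -∑' k : ℤ, (k : ℝ) * (p k).toReal := by
    rw [← tsum_neg, ← (Equiv.neg ℤ).tsum_eq]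
    exact tsum_congr fun k => by simp [hp_symm]
  linarith

section SquareIntegrable

variable (hL : MemLp (fun k : ℤ => (k : ℝ)) 2 p.toMeasure)
include hL

theorem memLp_jump_apply (i : ℕ) : MemLp (fun ξ : ℕ → ℤ => (ξ i : ℝ)) 2 (walkLaw p) :=
  hL.comp_measurePreserving (measurePreserving_jump p i)

theorem integral_jump_eq_tsum :
    ∫ k : ℤ, (k : ℝ) ∂p.toMeasure = ∑' k : ℤ, (k : ℝ) * (p k).toReal := by
  simp [PMF.integral_eq_tsum _ _ (hL.integrable one_le_two), mul_comm]

theorem meanAbsJump_eq_integral : meanAbsJump p = ∫ k : ℤ, |(k : ℝ)| ∂p.toMeasure := by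
  simp [meanAbsJump, PMF.integral_eq_tsum _ _ (hL.integrable one_le_two).abs, mul_comm]

theorem ofReal_meanAbsJump :
    ENNReal.ofReal (meanAbsJump p) = ∫⁻ k : ℤ, ‖(k : ℝ)‖ₑ ∂p.toMeasure := by
  rw [meanAbsJump_eq_integral hL]
  exact ofReal_integral_norm_eq_lintegral_enorm (hL.integrable one_le_two)

theorem meanAbsJump_pos (hv : jumpVariance p ≠ 0) : 0 < meanAbsJump p := by
  rw [meanAbsJump_eq_integral hL]
  refine (integral_nonneg fun k => abs_nonneg _).lt_of_ne' fun h => hv ?_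
  rw [integral_eq_zero_iff_of_nonneg (fun k => abs_nonneg _) (hL.integrable one_le_two).abs] at h
  have h0 : (fun k : ℤ => (k : ℝ)) =ᵐ[p.toMeasure] 0 := h.mono fun k hk => abs_eq_zero.1 hk
  rw [jumpVariance, variance_congr h0, variance_zero]

variable (h0 : ∫ k : ℤ, (k : ℝ) ∂p.toMeasure = 0)
include h0

theorem jumpVariance_eq_tsum : jumpVariance p = ∑' k : ℤ, (k : ℝ) ^ 2 * (p k).toReal := by
  rw [jumpVariance, variance_of_integral_eq_zero hL.aemeasurable h0,
    PMF.integral_eq_tsum _ _ hL.integrable_sq]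
  simp [mul_comm]

theorem integral_sq_walk (n : ℕ) :
    ∫ ξ, (walk ξ n : ℝ) ^ 2 ∂(walkLaw p) = n * jumpVariance p := by
  simp only [walk_cast]
  exact integral_sum_range_sq (iIndepFun_comp_jump p _) (memLp_jump_apply hL)
    (fun i => (identDistrib_comp_jump p _ i).integral_eq.trans h0)
    (fun i => (identDistrib_comp_jump p _ i).variance_eq) n

theorem tendsto_scaledMoment_two :
    Tendsto (scaledMoment p 2) atTop (𝓝 (ENNReal.ofReal (jumpVariance p))) := by
  refine tendsto_const_nhds.congr' ?_
  filter_upwards [eventually_ne_atTop 0] with n hn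
  have hint : Integrable (fun ξ => (walk ξ n : ℝ) ^ 2) (walkLaw p) := by
    simp only [walk_cast]
    exact (memLp_finsetSum _ fun i _ => memLp_jump_apply hL i).integrable_sq
  simp only [scaledMoment, Real.rpow_two, sq_abs]
  rw [← ofReal_integral_eq_lintegral_ofReal hint (ae_of_all _ fun ξ => sq_nonneg _),
    integral_sq_walk hL h0, ENNReal.ofReal_mul n.cast_nonneg, ENNReal.ofReal_natCast,
    div_self two_ne_zero, ENNReal.rpow_one, mul_comm,
    ENNReal.mul_div_cancel_right (by simpa using hn) (by simp)]

theorem limitMoment_two : limitMoment p 2 = ENNReal.ofReal (jumpVariance p) :=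
  (tendsto_scaledMoment_two hL h0).limUnder_eq

theorem measure_exists_le_abs_walk_sub_le (a n : ℕ) {r : ℝ} (hr : 0 < r) :
    walkLaw p {ξ | ∃ k, a ≤ k ∧ k ≤ a + n ∧ r ≤ |(walk ξ k : ℝ) - walk ξ a|} ≤
      ENNReal.ofReal (n * jumpVariance p / r ^ 2) := by
  refine (measure_mono ?_).trans <| kolmogorov_maximal_ineq (r := r)
    ((iIndepFun_comp_jump p fun k : ℤ => (k : ℝ)).precomp (add_right_injective a))
    (fun i => measurable_from_top.comp (measurable_pi_apply (a + i)))
    (fun i => memLp_jump_apply hL (a + i))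
    (fun i => (identDistrib_comp_jump p _ (a + i)).integral_eq.trans h0)
    (fun i => (identDistrib_comp_jump p _ (a + i)).variance_eq) n hr
  rintro ξ ⟨k, hak, hkn, hle⟩
  refine ⟨k - a, by omega, hle.trans_eq ?_⟩
  rw [walk_cast, walk_cast, ← Finset.sum_range_add_sum_Ico _ hak, add_sub_cancel_left,
    Finset.sum_Ico_eq_sum_range]

variable (hv : jumpVariance p ≠ 0)
include hv

theorem tendsto_measure_abs_walk_le (R : ℝ) :
    Tendsto (fun n => walkLaw p {ξ | |(walk ξ n : ℝ)| ≤ R}) atTop (𝓝 0) := by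
  simp only [walk_cast]
  have hident := identDistrib_comp_jump p fun k : ℤ => (k : ℝ)
  exact tendsto_measure_abs_sum_range_le (iIndepFun_comp_jump p _)
    (fun i => (hident i).trans (hident 0).symm) (memLp_jump_apply hL 0)
    ((hident 0).integral_eq.trans h0) ((hident 0).variance_eq.trans_ne hv) R

end SquareIntegrable

end Jumps

/-! ### Edges crossed by the walk -/

theorem measurePreserving_shift (p : PMF ℤ) (k : ℕ) :
    MeasurePreserving (fun (ξ : ℕ → ℤ) i => ξ (k + i)) (walkLaw p) (walkLaw p) := by
  refine ⟨by fun_prop, ?_⟩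
  have hi : iIndepFun (fun (i : ℕ) (ξ : ℕ → ℤ) => ξ (k + i)) (walkLaw p) :=
    (iIndepFun_infinitePi (X := fun (_ : ℕ) (a : ℤ) => a) fun _ => measurable_id).precomp
      (add_right_injective k)
  rw [(iIndepFun_iff_map_fun_eq_infinitePi_map (fun i => measurable_pi_apply (k + i))).1 hi]
  simp_rw [fun i => (measurePreserving_jump p (k + i)).map_eq]
  rfl

theorem walk_succ (ξ : ℕ → ℤ) (n : ℕ) : walk ξ (n + 1) = walk ξ n + ξ n :=
  Finset.sum_range_succ ..

theorem walk_shift (ξ : ℕ → ℤ) (k n : ℕ) :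
    walk (fun i => ξ (k + i)) n = walk ξ (k + n) - walk ξ k :=
  eq_sub_of_add_eq' (Finset.sum_range_add ..).symm

/-- The edges of `ℤ` between the sites `x` and `y`; the edge `j` joins `j - 1` to `j`, and so
carries the gap `ζ_j`. -/
noncomputable def edges (x y : ℤ) : Finset ℤ := Finset.Ioc (min x y) (max x y)

/-- The edges crossed by the jump `ξ k`. -/
noncomputable def crossed (ξ : ℕ → ℤ) (k : ℕ) : Finset ℤ := edges (walk ξ k) (walk ξ (k + 1))

theorem card_crossed (ξ : ℕ → ℤ) (k : ℕ) : ((crossed ξ k).card : ℝ) = |(ξ k : ℝ)| := by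
  rw [crossed, edges, Int.card_Ioc, max_sub_min_eq_abs, walk_succ, add_sub_cancel_left,
    ← Int.cast_natCast, Int.toNat_of_nonneg (abs_nonneg _), Int.cast_abs]

theorem edges_add (x y a : ℤ) : edges (x + a) (y + a) = (edges x y).map (addRightEmbedding a) := by
  simp [edges, min_add_add_right, max_add_add_right]

theorem crossed_shift (ξ : ℕ → ℤ) (k l : ℕ) :
    crossed (fun i => ξ (k + i)) l =
      (crossed ξ (k + l)).map (addRightEmbedding (-walk ξ k)) := by
  simp only [crossed, ← edges_add, walk_shift, ← sub_eq_add_neg, add_assoc]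

theorem measurable_card_crossed_inter (k l : ℕ) :
    Measurable fun ξ : ℕ → ℤ => ((crossed ξ k ∩ crossed ξ l).card : ℝ) := by
  have hcard : Measurable fun z : (ℤ × ℤ) × (ℤ × ℤ) =>
      ((edges z.1.1 z.1.2 ∩ edges z.2.1 z.2.2).card : ℝ) := measurable_of_countable _
  exact hcard.comp (f := fun ξ => ((walk ξ k, walk ξ (k + 1)), (walk ξ l, walk ξ (l + 1))))
    (((measurable_walk k).prodMk (measurable_walk (k + 1))).prodMk
      ((measurable_walk l).prodMk (measurable_walk (l + 1))))

theorem abs_walk_le_of_nonempty_crossed_inter {ξ : ℕ → ℤ} {m : ℕ}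
    (h : (crossed ξ 0 ∩ crossed ξ m).Nonempty) : |walk ξ m| ≤ |ξ 0| + |ξ m| := by
  obtain ⟨j, hj⟩ := h
  simp only [crossed, edges, walk_succ, Finset.mem_inter, Finset.mem_Ioc,
    show walk ξ 0 = 0 from rfl] at hj
  rw [abs_le]
  grind

/-- The number of pairs of crossings of a common edge during the first `n` jumps. -/
noncomputable def crossingPairs (ξ : ℕ → ℤ) (n : ℕ) : ℕ :=
  ∑ k ∈ Finset.range n, ∑ l ∈ Finset.range n, (crossed ξ k ∩ crossed ξ l).card

/-- The expected number of edges crossed by both of two given jumps that are `m` steps apart; by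
stationarity, the earlier of the two may be taken to be the first jump. -/
noncomputable def meanOverlap (p : PMF ℤ) (m : ℕ) : ℝ :=
  ∫ ξ, ((crossed ξ 0 ∩ crossed ξ m).card : ℝ) ∂(walkLaw p)

theorem sum_comp_dist_le {a : ℕ → ℝ} (ha : ∀ m, 0 ≤ a m) {k n : ℕ} (hk : k < n) :
    ∑ l ∈ Finset.range n, a (Nat.dist k l) ≤ 2 * ∑ m ∈ Finset.range n, a m := by
  rw [← Finset.sum_range_add_sum_Ico _ hk.le, two_mul]
  refine add_le_add ?_ ?_
  · rw [← Finset.sum_range_reflect]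
    calc ∑ j ∈ Finset.range k, a (Nat.dist k (k - 1 - j))
        = ∑ j ∈ Finset.range k, a (j + 1) := by
          refine Finset.sum_congr rfl fun j hj => ?_
          rw [Finset.mem_range] at hj
          congr 1
          rw [Nat.dist_eq_sub_of_le_right (by omega)]
          omega
      _ ≤ ∑ m ∈ Finset.range (k + 1), a m := by
          rw [Finset.sum_range_succ']
          exact le_add_of_nonneg_right (ha 0)
      _ ≤ ∑ m ∈ Finset.range n, a m :=
          Finset.sum_le_sum_of_subset_of_nonneg (Finset.range_subset_range.2 hk) fun m _ _ => ha m
  · rw [Finset.sum_Ico_eq_sum_range]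
    simp only [Nat.dist_eq_sub_of_le (Nat.le_add_right k _), Nat.add_sub_cancel_left]
    exact Finset.sum_le_sum_of_subset_of_nonneg (Finset.range_subset_range.2 (n.sub_le k))
      fun m _ _ => ha m

section CrossedEdges

variable {p : PMF ℤ}

theorem integral_card_crossed_inter (k l : ℕ) :
    ∫ ξ, ((crossed ξ k ∩ crossed ξ l).card : ℝ) ∂(walkLaw p) = meanOverlap p (Nat.dist k l) := by
  wlog hkl : k ≤ l generalizing k l
  · simpa only [Finset.inter_comm, Nat.dist_comm] using this l k (le_of_not_ge hkl)
  obtain ⟨m, rfl⟩ := Nat.exists_eq_add_of_le hkl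
  rw [Nat.dist_eq_sub_of_le hkl, Nat.add_sub_cancel_left, meanOverlap]
  conv_rhs => rw [← (measurePreserving_shift p k).map_eq]
  rw [integral_map (measurePreserving_shift p k).aemeasurable
    (measurable_card_crossed_inter 0 m).aestronglyMeasurable]
  simp only [crossed_shift, ← Finset.map_inter, Finset.card_map, add_zero]

theorem tendsto_measure_crossed_inter_nonempty
    (hS : ∀ R : ℝ, Tendsto (fun n => walkLaw p {ξ | |(walk ξ n : ℝ)| ≤ R}) atTop (𝓝 0)) :
    Tendsto (fun m => walkLaw p {ξ | (crossed ξ 0 ∩ crossed ξ m).Nonempty}) atTop (𝓝 0) := by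
  have htail : Tendsto (fun R : ℕ => p.toMeasure {k : ℤ | (R : ℤ) < |k|}) atTop (𝓝 0) := by
    rw [← measure_empty (μ := p.toMeasure), ← show ⋂ R : ℕ, {k : ℤ | (R : ℤ) < |k|} = ∅ by
      refine Set.eq_empty_of_forall_notMem fun k hk => ?_
      have := Set.mem_iInter.1 hk k.natAbs
      simp at this]
    exact tendsto_measure_iInter_atTop
      (fun R => (Set.to_countable _).measurableSet.nullMeasurableSet)
      (fun M N hMN k (hk : (N : ℤ) < |k|) => (Nat.cast_le.2 hMN).trans_lt hk)
      ⟨0, measure_ne_top _ _⟩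
  refine ENNReal.tendsto_nhds_zero.2 fun ε hε => ?_
  obtain ⟨R, hR⟩ := (ENNReal.tendsto_nhds_zero.1 htail (ε / 3) (by simpa using hε.ne')).exists
  have hjump (i : ℕ) : walkLaw p {ξ | (R : ℤ) < |ξ i|} ≤ ε / 3 :=
    ((measurePreserving_jump p i).measure_preimage
      (Set.to_countable {k : ℤ | (R : ℤ) < |k|}).measurableSet.nullMeasurableSet).trans_le hR
  filter_upwards [ENNReal.tendsto_nhds_zero.1 (hS (2 * R)) (ε / 3) (by simpa using hε.ne')]
    with m hm
  have hsub : {ξ | (crossed ξ 0 ∩ crossed ξ m).Nonempty} ⊆ {ξ | |(walk ξ m : ℝ)| ≤ 2 * R} ∪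
      ({ξ | (R : ℤ) < |ξ 0|} ∪ {ξ | (R : ℤ) < |ξ m|}) := by
    refine fun ξ hξ => or_iff_not_imp_right.2 fun hξR => ?_
    have hle := abs_walk_le_of_nonempty_crossed_inter hξ
    simp only [Set.mem_union, Set.mem_ofPred_eq, not_or, not_lt] at hξR
    have : |walk ξ m| ≤ 2 * R := by linarith
    exact_mod_cast this
  calc walkLaw p {ξ | (crossed ξ 0 ∩ crossed ξ m).Nonempty}
      ≤ ε / 3 + (ε / 3 + ε / 3) := (measure_mono hsub).trans <| (measure_union_le _ _).trans <|
        add_le_add hm <| (measure_union_le _ _).trans <| add_le_add (hjump 0) (hjump m)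
    _ = ε := by rw [← add_assoc, ENNReal.add_thirds]

variable (hL : MemLp (fun k : ℤ => (k : ℝ)) 2 p.toMeasure)
include hL

theorem integrable_card_crossed_inter (k l : ℕ) :
    Integrable (fun ξ : ℕ → ℤ => ((crossed ξ k ∩ crossed ξ l).card : ℝ)) (walkLaw p) :=
  ((memLp_jump_apply hL k).integrable one_le_two).abs.mono'
    (measurable_card_crossed_inter k l).aestronglyMeasurable <| ae_of_all _ fun ξ => by
      rw [Real.norm_natCast]
      exact (Nat.cast_le.2 (Finset.card_le_card Finset.inter_subset_left)).trans_eq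
        (card_crossed ξ k)

theorem integrable_crossingPairs (n : ℕ) :
    Integrable (fun ξ : ℕ → ℤ => (crossingPairs ξ n : ℝ)) (walkLaw p) := by
  simp only [crossingPairs, Nat.cast_sum]
  exact integrable_finsetSum _ fun k _ => integrable_finsetSum _ fun l _ =>
    integrable_card_crossed_inter hL k l

theorem integral_crossingPairs_le (n : ℕ) :
    ∫ ξ, (crossingPairs ξ n : ℝ) ∂(walkLaw p) ≤
      n * (2 * ∑ m ∈ Finset.range n, meanOverlap p m) := by
  have hrow (k : ℕ) (hk : k ∈ Finset.range n) := sum_comp_dist_le (a := meanOverlap p)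
    (fun m => integral_nonneg fun ξ => Nat.cast_nonneg _) (Finset.mem_range.1 hk)
  simp only [crossingPairs, Nat.cast_sum]
  rw [integral_finsetSum _ fun k _ => integrable_finsetSum _ fun l _ =>
    integrable_card_crossed_inter hL k l]
  simp only [integral_finsetSum _ fun l _ => integrable_card_crossed_inter hL _ l,
    integral_card_crossed_inter]
  simpa using Finset.sum_le_card_nsmul _ _ _ hrow

variable (h0 : ∫ k : ℤ, (k : ℝ) ∂p.toMeasure = 0) (hv : jumpVariance p ≠ 0)
include h0 hv

theorem tendsto_meanOverlap : Tendsto (meanOverlap p) atTop (𝓝 0) := by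
  have hint := ((memLp_jump_apply hL 0).integrable one_le_two).abs
  refine squeeze_zero (fun m => integral_nonneg fun ξ => Nat.cast_nonneg _) (fun m => ?_)
    (hint.tendsto_setIntegral_nhds_zero
      (tendsto_measure_crossed_inter_nonempty (tendsto_measure_abs_walk_le hL h0 hv)))
  rw [meanOverlap, ← setIntegral_eq_integral_of_forall_compl_eq_zero
    (s := {ξ | (crossed ξ 0 ∩ crossed ξ m).Nonempty}) fun ξ hξ => by
      simpa [Finset.not_nonempty_iff_eq_empty] using hξ]
  refine setIntegral_mono (integrable_card_crossed_inter hL 0 m).integrableOn hint.integrableOn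
    fun ξ => ?_
  simp only [← card_crossed]
  exact Nat.cast_le.2 (Finset.card_le_card Finset.inter_subset_left)

theorem tendsto_integral_crossingPairs_div :
    Tendsto (fun n : ℕ => (∫ ξ, (crossingPairs ξ n : ℝ) ∂(walkLaw p)) / n ^ 2) atTop (𝓝 0) := by
  have hcesaro := (tendsto_meanOverlap hL h0 hv).cesaro.const_mul 2
  rw [mul_zero] at hcesaro
  refine squeeze_zero (fun n => by positivity) (fun n => ?_) hcesaro
  rcases eq_or_ne n 0 with rfl | hn
  · simp
  rw [div_le_iff₀ (by positivity)]
  refine (integral_crossingPairs_le hL n).trans_eq ?_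
  field_simp

end CrossedEdges

/-! ### Sums over the crossed gaps -/

section Gaps

variable (ν : Measure ℝ) [IsProbabilityMeasure ν]

/-- The law of the i.i.d. gaps `(ζ_j)`, whose image under `targets` is `envLaw ν`. -/
noncomputable def gapLaw : Measure (ℤ → ℝ) := Measure.infinitePi fun _ : ℤ => ν

instance : IsProbabilityMeasure (gapLaw ν) := by unfold gapLaw; infer_instance

theorem measurePreserving_gap (j : ℤ) : MeasurePreserving (fun ζ : ℤ → ℝ => ζ j) (gapLaw ν) ν :=
  measurePreserving_eval_infinitePi (fun _ : ℤ => ν) j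

theorem iIndepFun_comp_gap {f : ℝ → ℝ} (hf : Measurable f) :
    iIndepFun (fun (j : ℤ) (ζ : ℤ → ℝ) => f (ζ j)) (gapLaw ν) :=
  iIndepFun_infinitePi (X := fun (_ : ℤ) (x : ℝ) => f x) fun _ => hf

theorem identDistrib_comp_gap {f : ℝ → ℝ} (hf : Measurable f) (j : ℤ) :
    IdentDistrib (fun ζ : ℤ → ℝ => f (ζ j)) f (gapLaw ν) ν :=
  .comp ⟨(measurable_pi_apply j).aemeasurable, aemeasurable_id, by
    rw [(measurePreserving_gap ν j).map_eq]; exact Measure.map_id.symm⟩ hf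

theorem integral_mul_comp_gap {f : ℝ → ℝ} (hf : Measurable f) (h0 : ∫ x, f x ∂ν = 0) (i j : ℤ) :
    ∫ ζ, f (ζ i) * f (ζ j) ∂(gapLaw ν) = if i = j then ∫ x, f x ^ 2 ∂ν else 0 := by
  split_ifs with h
  · simp only [h, ← pow_two]
    exact (identDistrib_comp_gap ν (hf.pow_const 2) j).integral_eq
  · refine (((iIndepFun_comp_gap ν hf).indepFun h).integral_fun_mul_eq_mul_integral
      (hf.comp (measurable_pi_apply i)).aestronglyMeasurable
      (hf.comp (measurable_pi_apply j)).aestronglyMeasurable).trans ?_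
    rw [(identDistrib_comp_gap ν hf i).integral_eq, h0, zero_mul]

end Gaps

/-- The sum of `f` over the gaps crossed during the first `n` jumps, with multiplicity. For `f = id`
and nonnegative gaps this is the `n`-th collision time. -/
noncomputable def crossingSum (f : ℝ → ℝ) (n : ℕ) (z : (ℤ → ℝ) × (ℕ → ℤ)) : ℝ :=
  ∑ k ∈ Finset.range n, ∑ j ∈ crossed z.2 k, f (z.1 j)

theorem measurable_sum_crossed {E : Type*} [MeasurableSpace E] [AddCommMonoid E] [MeasurableAdd₂ E]
    {f : ℝ → E} (hf : Measurable f) (k : ℕ) :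
    Measurable fun z : (ℤ → ℝ) × (ℕ → ℤ) => ∑ j ∈ crossed z.2 k, f (z.1 j) := by
  have hedges : Measurable fun y : (ℤ → ℝ) × (ℤ × ℤ) => ∑ j ∈ edges y.2.1 y.2.2, f (y.1 j) :=
    measurable_from_prod_countable_left fun a =>
      Finset.measurable_sum (edges a.1 a.2) fun j _ => hf.comp (measurable_pi_apply j)
  exact hedges.comp (f := fun z : (ℤ → ℝ) × (ℕ → ℤ) => (z.1, (walk z.2 k, walk z.2 (k + 1))))
    (measurable_fst.prodMk (((measurable_walk k).comp measurable_snd).prodMk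
      ((measurable_walk (k + 1)).comp measurable_snd)))

theorem measurable_crossingSum {f : ℝ → ℝ} (hf : Measurable f) (n : ℕ) :
    Measurable (crossingSum f n) :=
  Finset.measurable_sum _ fun k _ => measurable_sum_crossed hf k

theorem crossingSum_add (f g : ℝ → ℝ) (n : ℕ) :
    crossingSum (f + g) n = crossingSum f n + crossingSum g n := by
  ext z
  simp only [crossingSum, Pi.add_apply, Finset.sum_add_distrib]

section Joint

/-- The joint law of the gaps and the jumps. -/
noncomputable def jointLaw (ν : Measure ℝ) [IsProbabilityMeasure ν] (p : PMF ℤ) :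
    Measure ((ℤ → ℝ) × (ℕ → ℤ)) :=
  (gapLaw ν).prod (walkLaw p)

variable {ν : Measure ℝ} [IsProbabilityMeasure ν] {p : PMF ℤ}

instance : IsProbabilityMeasure (jointLaw ν p) := by unfold jointLaw; infer_instance

theorem measurePreserving_fst_jointLaw :
    MeasurePreserving Prod.fst (jointLaw ν p) (gapLaw ν) :=
  measurePreserving_fst

theorem measurePreserving_snd_jointLaw :
    MeasurePreserving Prod.snd (jointLaw ν p) (walkLaw p) :=
  measurePreserving_snd

theorem integral_sq_crossingSum {f : ℝ → ℝ} (hf : Measurable f) (hi : MemLp f 2 ν)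
    (h0 : ∫ x, f x ∂ν = 0) (n : ℕ) (ξ : ℕ → ℤ) :
    ∫ ζ, crossingSum f n (ζ, ξ) ^ 2 ∂(gapLaw ν) = (∫ x, f x ^ 2 ∂ν) * crossingPairs ξ n := by
  have hprod (i j : ℤ) : Integrable (fun ζ : ℤ → ℝ => f (ζ i) * f (ζ j)) (gapLaw ν) :=
    (hi.comp_measurePreserving (measurePreserving_gap ν i)).integrable_mul
      (hi.comp_measurePreserving (measurePreserving_gap ν j))
  simp only [crossingSum, pow_two, Finset.sum_mul_sum]
  rw [integral_finsetSum _ fun k _ => integrable_finsetSum _ fun l _ =>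
    integrable_finsetSum _ fun i _ => integrable_finsetSum _ fun j _ => hprod i j]
  simp only [crossingPairs, Nat.cast_sum, Finset.mul_sum]
  refine Finset.sum_congr rfl fun k _ => ?_
  rw [integral_finsetSum _ fun l _ =>
    integrable_finsetSum _ fun i _ => integrable_finsetSum _ fun j _ => hprod i j]
  refine Finset.sum_congr rfl fun l _ => ?_
  rw [integral_finsetSum _ fun i _ => integrable_finsetSum _ fun j _ => hprod i j]
  simp only [integral_finsetSum _ fun j _ => hprod _ j, integral_mul_comp_gap ν hf h0, ← pow_two,
    Finset.sum_ite_eq, ← Finset.sum_filter, Finset.filter_mem_eq_inter, Finset.sum_const,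
    nsmul_eq_mul, mul_comm]

theorem lintegral_sum_enorm_crossed (hL : MemLp (fun k : ℤ => (k : ℝ)) 2 p.toMeasure)
    {f : ℝ → ℝ} (hf : Measurable f) (k : ℕ) :
    ∫⁻ z, ∑ j ∈ crossed z.2 k, ‖f (z.1 j)‖ₑ ∂(jointLaw ν p) =
      ENNReal.ofReal (meanAbsJump p) * eLpNorm f 1 ν := by
  rw [jointLaw, lintegral_prod_symm _ (measurable_sum_crossed hf.enorm k).aemeasurable]
  have hgap (ξ : ℕ → ℤ) : ∫⁻ ζ, ∑ j ∈ crossed ξ k, ‖f (ζ j)‖ₑ ∂(gapLaw ν) =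
      ‖(ξ k : ℝ)‖ₑ * eLpNorm f 1 ν := by
    rw [lintegral_finsetSum _ fun j _ => by fun_prop]
    simp only [fun j => (measurePreserving_gap ν j).lintegral_comp hf.enorm,
      ← eLpNorm_one_eq_lintegral_enorm, Finset.sum_const, nsmul_eq_mul]
    rw [Real.enorm_eq_ofReal_abs, ← card_crossed, ENNReal.ofReal_natCast]
  have hmeas : Measurable fun k : ℤ => ‖(k : ℝ)‖ₑ := measurable_of_countable _
  simp only [hgap]
  rw [lintegral_mul_const _ (by fun_prop), (measurePreserving_jump p k).lintegral_comp hmeas,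
    ofReal_meanAbsJump hL]

theorem eLpNorm_crossingSum_one_le (hL : MemLp (fun k : ℤ => (k : ℝ)) 2 p.toMeasure)
    {f : ℝ → ℝ} (hf : Measurable f) (n : ℕ) :
    eLpNorm (crossingSum f n) 1 (jointLaw ν p) ≤
      n * (ENNReal.ofReal (meanAbsJump p) * eLpNorm f 1 ν) := by
  calc eLpNorm (crossingSum f n) 1 (jointLaw ν p)
      ≤ ∫⁻ z, ∑ k ∈ Finset.range n, ∑ j ∈ crossed z.2 k, ‖f (z.1 j)‖ₑ ∂(jointLaw ν p) := by
        rw [eLpNorm_one_eq_lintegral_enorm]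
        exact lintegral_mono fun z => (enorm_sum_le _ _).trans
          (Finset.sum_le_sum fun k _ => enorm_sum_le _ _)
    _ = n * (ENNReal.ofReal (meanAbsJump p) * eLpNorm f 1 ν) := by
        rw [lintegral_finsetSum _ fun k _ => measurable_sum_crossed hf.enorm k]
        simp only [lintegral_sum_enorm_crossed hL hf, Finset.sum_const, Finset.card_range,
          nsmul_eq_mul]

theorem eLpNorm_crossingSum_two_sq (hL : MemLp (fun k : ℤ => (k : ℝ)) 2 p.toMeasure)
    {f : ℝ → ℝ} (hf : Measurable f) (hi : MemLp f 2 ν) (h0 : ∫ x, f x ∂ν = 0) (n : ℕ) :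
    eLpNorm (crossingSum f n) 2 (jointLaw ν p) ^ 2 =
      ENNReal.ofReal ((∫ x, f x ^ 2 ∂ν) * ∫ ξ, (crossingPairs ξ n : ℝ) ∂(walkLaw p)) := by
  have hfiber (ξ : ℕ → ℤ) : ∫⁻ ζ, ‖crossingSum f n (ζ, ξ)‖ₑ ^ 2 ∂(gapLaw ν) =
      ENNReal.ofReal ((∫ x, f x ^ 2 ∂ν) * crossingPairs ξ n) := by
    have hmem : MemLp (fun ζ => crossingSum f n (ζ, ξ)) 2 (gapLaw ν) :=
      memLp_finsetSum _ fun k _ => memLp_finsetSum (crossed ξ k) fun j _ =>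
        hi.comp_measurePreserving (measurePreserving_gap ν j)
    rw [← integral_sq_crossingSum hf hi h0, ofReal_integral_eq_lintegral_ofReal hmem.integrable_sq
      (ae_of_all _ fun ζ => sq_nonneg _)]
    simp only [← sq_abs (crossingSum f n _), ENNReal.ofReal_pow (abs_nonneg _),
      Real.enorm_eq_ofReal_abs]
  have hsq := eLpNorm_nnreal_pow_eq_lintegral (f := crossingSum f n) (μ := jointLaw ν p)
    (two_ne_zero' ℝ≥0)
  simp only [NNReal.coe_ofNat, ENNReal.coe_ofNat, ENNReal.rpow_ofNat] at hsq
  rw [hsq, jointLaw, lintegral_prod_symm _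
    ((measurable_crossingSum hf n).enorm.pow_const 2).aemeasurable]
  simp only [hfiber]
  rw [← ofReal_integral_eq_lintegral_ofReal ((integrable_crossingPairs hL n).const_mul _)
    (ae_of_all _ fun ξ => mul_nonneg (integral_nonneg fun x => sq_nonneg _) (Nat.cast_nonneg _)),
    integral_const_mul]

theorem tendsto_eLpNorm_crossingSum_div_of_memLp_two
    (hL : MemLp (fun k : ℤ => (k : ℝ)) 2 p.toMeasure)
    (h0 : ∫ k : ℤ, (k : ℝ) ∂p.toMeasure = 0) (hv : jumpVariance p ≠ 0)
    {f : ℝ → ℝ} (hf : Measurable f) (hi : MemLp f 2 ν) (hf0 : ∫ x, f x ∂ν = 0) :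
    Tendsto (fun n : ℕ => eLpNorm (crossingSum f n) 1 (jointLaw ν p) / n) atTop (𝓝 0) := by
  have hpairs := ENNReal.tendsto_ofReal
    ((tendsto_integral_crossingPairs_div hL h0 hv).const_mul (∫ x, f x ^ 2 ∂ν))
  rw [mul_zero, ENNReal.ofReal_zero] at hpairs
  have hsqrt := hpairs.ennrpow_const (2⁻¹ : ℝ)
  rw [ENNReal.zero_rpow_of_pos (by positivity)] at hsqrt
  refine tendsto_of_tendsto_of_tendsto_of_le_of_le' tendsto_const_nhds hsqrt
    (Eventually.of_forall fun n => zero_le) ?_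
  filter_upwards [eventually_gt_atTop 0] with n hn
  rw [ENNReal.le_rpow_inv_iff two_pos, ENNReal.rpow_two, ← mul_div_assoc,
    ENNReal.ofReal_div_of_pos (by positivity), ← eLpNorm_crossingSum_two_sq hL hf hi hf0,
    ENNReal.ofReal_pow (by positivity), ENNReal.ofReal_natCast]
  simp only [div_eq_mul_inv, mul_pow, ENNReal.inv_pow]
  gcongr
  exact eLpNorm_le_eLpNorm_of_exponent_le one_le_two
    (measurable_crossingSum hf n).aestronglyMeasurable

theorem exists_memLp_two_eLpNorm_sub_le {f : ℝ → ℝ} (hi : Integrable f ν)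
    (hf0 : ∫ x, f x ∂ν = 0) {ε : ℝ≥0∞} (hε : ε ≠ 0) :
    ∃ g : ℝ → ℝ, Measurable g ∧ MemLp g 2 ν ∧ ∫ x, g x ∂ν = 0 ∧ eLpNorm (f - g) 1 ν ≤ ε := by
  obtain ⟨g, hg, -⟩ := (memLp_one_iff_integrable.2 hi).exists_boundedContinuous_eLpNorm_sub_le
    ENNReal.one_ne_top (ε := ε / 2) (by simpa using hε)
  have hgi : Integrable g ν := g.integrable ν
  set c := ∫ x, g x ∂ν with hc
  refine ⟨fun x => g x - c, g.continuous.measurable.sub_const c,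
    (MemLp.of_bound g.continuous.aestronglyMeasurable ‖g‖
      (ae_of_all _ g.norm_coe_le_norm)).sub (memLp_const c), ?_, ?_⟩
  · rw [integral_sub hgi (integrable_const c), integral_const, probReal_univ, one_smul, sub_self]
  have hmean : ‖c‖ₑ ≤ ε / 2 := by
    rw [← enorm_neg, ← zero_sub, ← hf0, hc, ← integral_sub hi hgi]
    exact (enorm_integral_le_lintegral_enorm _).trans
      (eLpNorm_one_eq_lintegral_enorm.symm.trans_le hg)
  calc eLpNorm (f - fun x => g x - c) 1 ν = eLpNorm ((f - ⇑g) + fun _ => c) 1 ν := by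
        congr 1
        ext x
        simp only [Pi.sub_apply, Pi.add_apply]
        ring
    _ ≤ eLpNorm (f - ⇑g) 1 ν + eLpNorm (fun _ => c) 1 ν :=
        eLpNorm_add_le (hi.sub hgi).aestronglyMeasurable aestronglyMeasurable_const le_rfl
    _ ≤ ε / 2 + ε / 2 := by
        refine add_le_add hg (le_trans ?_ hmean)
        simp [eLpNorm_one_eq_lintegral_enorm]
    _ = ε := ENNReal.add_halves ε

theorem tendsto_eLpNorm_crossingSum_div
    (hL : MemLp (fun k : ℤ => (k : ℝ)) 2 p.toMeasure)
    (h0 : ∫ k : ℤ, (k : ℝ) ∂p.toMeasure = 0) (hv : jumpVariance p ≠ 0)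
    {f : ℝ → ℝ} (hf : Measurable f) (hi : Integrable f ν) (hf0 : ∫ x, f x ∂ν = 0) :
    Tendsto (fun n : ℕ => eLpNorm (crossingSum f n) 1 (jointLaw ν p) / n) atTop (𝓝 0) := by
  refine ENNReal.tendsto_nhds_zero.2 fun ε hε => ?_
  have hm := meanAbsJump_pos hL hv
  obtain ⟨g, hgm, hg2, hg0, hfg⟩ := exists_memLp_two_eLpNorm_sub_le hi hf0
    (ε := ε / 2 / ENNReal.ofReal (meanAbsJump p)) (by simpa using hε.ne')
  filter_upwards [ENNReal.tendsto_nhds_zero.1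
    (tendsto_eLpNorm_crossingSum_div_of_memLp_two hL h0 hv hgm hg2 hg0) (ε / 2)
    (by simpa using hε.ne')] with n hn
  calc eLpNorm (crossingSum f n) 1 (jointLaw ν p) / n
      ≤ (eLpNorm (crossingSum (f - g) n) 1 (jointLaw ν p) +
          eLpNorm (crossingSum g n) 1 (jointLaw ν p)) / n := by
        gcongr
        conv_lhs => rw [← sub_add_cancel f g, crossingSum_add]
        exact eLpNorm_add_le (measurable_crossingSum (hf.sub hgm) n).aestronglyMeasurable
          (measurable_crossingSum hgm n).aestronglyMeasurable le_rfl
    _ ≤ ENNReal.ofReal (meanAbsJump p) * (ε / 2 / ENNReal.ofReal (meanAbsJump p)) + ε / 2 := by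
        rw [ENNReal.add_div]
        refine add_le_add (ENNReal.div_le_of_le_mul' ?_) hn
        exact (eLpNorm_crossingSum_one_le hL (hf.sub hgm) n).trans (by gcongr)
    _ = ε := by
        rw [ENNReal.mul_div_cancel (by simpa using hm) ENNReal.ofReal_ne_top, ENNReal.add_halves]

end Joint

/-! ### The law of large numbers for the collision times -/

theorem eLpNorm_div_natCast_le {α : Type*} [MeasurableSpace α] {μ : Measure α} {q : ℝ≥0∞}
    (f : α → ℝ) (n : ℕ) : eLpNorm (fun x => f x / n) q μ ≤ eLpNorm f q μ / n := by
  rcases eq_or_ne n 0 with rfl | hn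
  · simp
  have hsmul := eLpNorm_const_smul (n : ℝ)⁻¹ f q μ
  rw [enorm_inv (by positivity), Real.enorm_natCast] at hsmul
  rw [ENNReal.div_eq_inv_mul, ← hsmul]
  simp only [div_eq_inv_mul]
  exact le_rfl

theorem targets_sub_targets (ζ : ℤ → ℝ) {x y : ℤ} (h : x ≤ y) :
    targets ζ y - targets ζ x = ∑ j ∈ Finset.Ioc x y, ζ j := by
  induction y, h using Int.leInduction with
  | base => simp
  | succ y hy ih =>
    rw [← Finset.insert_Ioc_right_eq_Ioc_add_one hy, Finset.sum_insert (by simp), ← ih,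
      targets_rec ζ (y + 1), add_sub_cancel_right]
    ring

theorem abs_targets_sub_targets {ζ : ℤ → ℝ} (hζ : ∀ j, 0 ≤ ζ j) (x y : ℤ) :
    |targets ζ y - targets ζ x| = ∑ j ∈ edges x y, ζ j := by
  wlog h : x ≤ y generalizing x y
  · rw [abs_sub_comm, this y x (le_of_not_ge h), edges, edges, min_comm, max_comm]
  rw [edges, min_eq_left h, max_eq_right h, targets_sub_targets ζ h,
    abs_of_nonneg (Finset.sum_nonneg fun j _ => hζ j)]

theorem collisionTime_targets {ζ : ℤ → ℝ} (hζ : ∀ j, 0 ≤ ζ j) (ξ : ℕ → ℤ) (n : ℕ) (m : ℝ) :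
    collisionTime (targets ζ) ξ n =
      crossingSum (fun x => x - m) n (ζ, ξ) + m * ∑ k ∈ Finset.range n, |(ξ k : ℝ)| := by
  rw [collisionTime, crossingSum, Finset.mul_sum, ← Finset.sum_add_distrib]
  refine Finset.sum_congr rfl fun k _ => ?_
  rw [abs_targets_sub_targets hζ, Finset.sum_sub_distrib, Finset.sum_const, nsmul_eq_mul,
    card_crossed, crossed]
  ring

section CollisionTime

variable {ν : Measure ℝ} [IsProbabilityMeasure ν] {p : PMF ℤ}

theorem ae_gap_nonneg (hν : ∀ᵐ x ∂ν, 0 ≤ x) : ∀ᵐ ζ ∂(gapLaw ν), ∀ j, 0 ≤ ζ j :=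
  ae_all_iff.2 fun j => (measurePreserving_gap ν j).quasiMeasurePreserving.ae hν

variable (hL : MemLp (fun k : ℤ => (k : ℝ)) 2 p.toMeasure)
include hL

theorem tendsto_eLpNorm_sum_abs_jump_div_sub :
    Tendsto (fun n : ℕ => eLpNorm (fun ξ : ℕ → ℤ =>
      (∑ k ∈ Finset.range n, |(ξ k : ℝ)|) / n - meanAbsJump p) 1 (walkLaw p)) atTop (𝓝 0) := by
  have hident (i : ℕ) := identDistrib_comp_jump p (fun k : ℤ => |(k : ℝ)|) i
  have hlaw := strong_law_Lp le_rfl ENNReal.one_ne_top (fun (i : ℕ) (ξ : ℕ → ℤ) => |(ξ i : ℝ)|)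
    (memLp_one_iff_integrable.2 ((memLp_jump_apply hL 0).integrable one_le_two).abs)
    (fun i j hij => (iIndepFun_comp_jump p fun k : ℤ => |(k : ℝ)|).indepFun hij)
    fun i => (hident i).trans (hident 0).symm
  rw [(hident 0).integral_eq, ← meanAbsJump_eq_integral hL] at hlaw
  simpa only [smul_eq_mul, inv_mul_eq_div] using hlaw

theorem tendsto_eLpNorm_collisionTime_div_sub (hν : ∀ᵐ x ∂ν, 0 ≤ x)
    (hν_int : Integrable (fun x : ℝ => x) ν) (h0 : ∫ k : ℤ, (k : ℝ) ∂p.toMeasure = 0)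
    (hv : jumpVariance p ≠ 0) :
    Tendsto (fun n : ℕ => eLpNorm (fun z => collisionTime (targets z.1) z.2 n / n -
      (∫ x, x ∂ν) * meanAbsJump p) 1 (jointLaw ν p)) atTop (𝓝 0) := by
  set m := ∫ x, x ∂ν with hm
  have hgap := tendsto_eLpNorm_crossingSum_div (ν := ν) hL h0 hv (f := fun x => x - m) (by fun_prop)
    (hν_int.sub (integrable_const m)) (by rw [integral_sub hν_int (integrable_const m)]; simp [hm])
  have hjump := ENNReal.Tendsto.const_mul (a := ‖m‖ₑ) (tendsto_eLpNorm_sum_abs_jump_div_sub hL)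
    (Or.inr enorm_ne_top)
  have hsum := hgap.add hjump
  rw [mul_zero, add_zero] at hsum
  refine tendsto_of_tendsto_of_tendsto_of_le_of_le tendsto_const_nhds hsum
    (fun n => zero_le) fun n => ?_
  have hjm : Measurable fun ξ : ℕ → ℤ =>
      (∑ k ∈ Finset.range n, |(ξ k : ℝ)|) / n - meanAbsJump p := by fun_prop
  calc eLpNorm (fun z => collisionTime (targets z.1) z.2 n / n - m * meanAbsJump p) 1 (jointLaw ν p)
      = eLpNorm ((fun z => crossingSum (fun x => x - m) n z / n) + m • fun z =>
          (∑ k ∈ Finset.range n, |(z.2 k : ℝ)|) / n - meanAbsJump p) 1 (jointLaw ν p) := by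
        refine eLpNorm_congr_ae ?_
        filter_upwards [measurePreserving_fst_jointLaw.quasiMeasurePreserving.ae
          (ae_gap_nonneg hν)] with z hz
        simp only [collisionTime_targets hz z.2 n m, Pi.add_apply, Pi.smul_apply, smul_eq_mul]
        ring
    _ ≤ eLpNorm (crossingSum (fun x => x - m) n) 1 (jointLaw ν p) / n + ‖m‖ₑ *
          eLpNorm (fun ξ : ℕ → ℤ => (∑ k ∈ Finset.range n, |(ξ k : ℝ)|) / n - meanAbsJump p) 1
            (walkLaw p) := by
        refine (eLpNorm_add_le ?_ ?_ le_rfl).trans (add_le_add ?_ ?_)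
        · exact ((measurable_crossingSum (by fun_prop) n).div_const _).aestronglyMeasurable
        · exact ((hjm.comp measurable_snd).const_smul m).aestronglyMeasurable
        · exact eLpNorm_div_natCast_le _ n
        · rw [eLpNorm_const_smul, ← eLpNorm_comp_measurePreserving hjm.aestronglyMeasurable
            (measurePreserving_snd_jointLaw (ν := ν))]
          rfl

end CollisionTime

/-! ### Linear growth of the targets -/

theorem exists_forall_abs_sub_le_of_tendsto_div {u : ℕ → ℝ} {m : ℝ}
    (h : Tendsto (fun n : ℕ => u n / n) atTop (𝓝 m)) {ε : ℝ} (hε : 0 < ε) :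
    ∃ C : ℝ, ∀ n : ℕ, |u n - m * n| ≤ ε * n + C := by
  obtain ⟨N, hN⟩ := Metric.tendsto_atTop.1 h ε hε
  have hsum : 0 ≤ ∑ n ∈ Finset.range (N + 1), |u n - m * n| :=
    Finset.sum_nonneg fun _ _ => abs_nonneg _
  refine ⟨∑ n ∈ Finset.range (N + 1), |u n - m * n|, fun n => ?_⟩
  rcases le_or_gt n N with hn | hn
  · have hterm := Finset.single_le_sum (f := fun n : ℕ => |u n - m * n|)
      (fun _ _ => abs_nonneg _) (Finset.mem_range_succ_iff.2 hn)
    have hεn : 0 ≤ ε * n := by positivity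
    linarith
  · have hn0 : (0 : ℝ) < n := by exact_mod_cast N.zero_le.trans_lt hn
    have hdist := (hN n hn.le).le
    rw [Real.dist_eq, div_sub' hn0.ne', abs_div, abs_of_pos hn0, div_le_iff₀ hn0,
      mul_comm (n : ℝ)] at hdist
    linarith

theorem targets_natCast (ζ : ℤ → ℝ) (n : ℕ) :
    targets ζ n = ∑ i ∈ Finset.range n, ζ ((i : ℤ) + 1) := by
  induction n with
  | zero => simp [targets_zero]
  | succ n ih =>
    rw [Finset.sum_range_succ, ← ih, targets_rec ζ ((n + 1 : ℕ) : ℤ)]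
    push_cast
    rw [add_sub_cancel_right]

theorem targets_neg_natCast (ζ : ℤ → ℝ) (n : ℕ) :
    targets ζ (-(n : ℤ)) = -∑ i ∈ Finset.range n, ζ (-(i : ℤ)) := by
  induction n with
  | zero => simp [targets_zero]
  | succ n ih =>
    rw [Finset.sum_range_succ, neg_add, ← ih, targets_rec ζ (-(n : ℤ))]
    push_cast
    rw [neg_add, ← sub_eq_add_neg]
    ring

section LinearGrowth

variable {ν : Measure ℝ} [IsProbabilityMeasure ν] (hν_int : Integrable (fun x : ℝ => x) ν)
include hν_int

theorem ae_tendsto_sum_gap_div {g : ℕ → ℤ} (hg : Function.Injective g) :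
    ∀ᵐ ζ ∂(gapLaw ν), Tendsto (fun n : ℕ => (∑ i ∈ Finset.range n, ζ (g i)) / (n : ℝ)) atTop
      (𝓝 (∫ x, x ∂ν)) := by
  have hident (i : ℕ) := identDistrib_comp_gap ν measurable_id (g i)
  have hlaw := strong_law_ae_real (μ := gapLaw ν) (fun (i : ℕ) (ζ : ℤ → ℝ) => ζ (g i))
    ((measurePreserving_gap ν (g 0)).integrable_comp_of_integrable hν_int)
    (fun i j hij => (iIndepFun_comp_gap ν measurable_id).indepFun (hg.ne hij))
    fun i => (hident i).trans (hident 0).symm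
  rwa [show ∫ ζ, ζ (g 0) ∂(gapLaw ν) = ∫ x, x ∂ν from (hident 0).integral_eq] at hlaw

theorem ae_exists_forall_abs_targets_sub_le {ε : ℝ} (hε : 0 < ε) :
    ∀ᵐ ζ ∂(gapLaw ν), ∃ C : ℝ, ∀ x : ℤ,
      |targets ζ x - (∫ x, x ∂ν) * x| ≤ ε * |(x : ℝ)| + C := by
  filter_upwards [ae_tendsto_sum_gap_div hν_int (g := fun i => (i : ℤ) + 1)
      (fun i j h => by simpa using h),
    ae_tendsto_sum_gap_div hν_int (g := fun i => -(i : ℤ)) (fun i j h => by simpa using h)]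
    with ζ hpos hneg
  obtain ⟨C₁, hC₁⟩ := exists_forall_abs_sub_le_of_tendsto_div hpos hε
  obtain ⟨C₂, hC₂⟩ := exists_forall_abs_sub_le_of_tendsto_div hneg hε
  refine ⟨max C₁ C₂, fun x => ?_⟩
  obtain ⟨n, rfl | rfl⟩ := x.eq_nat_or_neg
  · rw [targets_natCast, Int.cast_natCast, Nat.abs_cast]
    exact (hC₁ n).trans (by gcongr; exact le_max_left _ _)
  · rw [targets_neg_natCast, Int.cast_neg, Int.cast_natCast, abs_neg, Nat.abs_cast, mul_neg,
      ← neg_sub', abs_neg]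
    exact (hC₂ n).trans (by gcongr; exact le_max_right _ _)

theorem tendsto_measure_exists_lt_abs_targets_sub {ε : ℝ} (hε : 0 < ε) :
    Tendsto (fun L : ℝ => gapLaw ν {ζ | ∃ x : ℤ,
      ε * (|(x : ℝ)| + L) < |targets ζ x - (∫ x, x ∂ν) * x|}) atTop (𝓝 0) := by
  rw [← measure_empty (μ := gapLaw ν)]
  refine tendsto_measure_of_ae_tendsto_indicator_of_isFiniteMeasure atTop MeasurableSet.empty
    (fun L => ?_) ?_
  · simp only [Set.ofPred_exists]
    refine MeasurableSet.iUnion fun x => measurableSet_lt measurable_const ?_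
    exact (((measurable_pi_apply x).comp measurable_targets).sub_const _).abs
  · filter_upwards [ae_exists_forall_abs_targets_sub_le hν_int hε] with ζ ⟨C, hC⟩
    filter_upwards [eventually_ge_atTop (C / ε)] with L hL
    simp only [Set.mem_empty_iff_false, iff_false, not_exists, not_lt]
    intro x
    have hCL : C ≤ ε * L := by rwa [div_le_iff₀' hε] at hL
    linarith [hC x]

end LinearGrowth

/-! ### Approximation of the position by the walk -/

theorem exists_collisionTime_le_lt {ω : ℤ → ℝ} {ξ : ℕ → ℤ} {t : ℝ} {a b : ℕ}
    (ha : collisionTime ω ξ a ≤ t) (hb : t < collisionTime ω ξ b) :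
    ∃ n, a ≤ n ∧ n < b ∧ collisionTime ω ξ n ≤ t ∧ t < collisionTime ω ξ (n + 1) := by
  classical
  obtain ⟨d, rfl⟩ := Nat.exists_eq_add_of_lt ((collisionTime_mono ω ξ).reflect_lt (ha.trans_lt hb))
  have hex : ∃ m, t < collisionTime ω ξ (a + m + 1) := ⟨d, hb⟩
  refine ⟨a + Nat.find hex, by omega, ?_, ?_, Nat.find_spec hex⟩
  · have := Nat.find_min' hex hb
    omega
  · rcases h : Nat.find hex with _ | m
    · simpa using ha
    · exact not_lt.1 (Nat.find_min hex (by omega))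

theorem abs_position_sub_le_abs_jump {ω : ℤ → ℝ} {ξ : ℕ → ℤ} {t : ℝ≥0} {n : ℕ}
    (h₁ : collisionTime ω ξ n ≤ t) (h₂ : (t : ℝ) < collisionTime ω ξ (n + 1)) :
    |position ω ξ t - ω (walk ξ n)| ≤ |ω (walk ξ (n + 1)) - ω (walk ξ n)| := by
  have hsign : |((ξ n).sign : ℝ)| ≤ 1 := by
    rcases Int.sign_trichotomy (ξ n) with h | h | h <;> simp [h]
  have hstep : collisionTime ω ξ (n + 1) = collisionTime ω ξ n +
      |ω (walk ξ (n + 1)) - ω (walk ξ n)| := by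
    rw [collisionTime, collisionTime, Finset.sum_range_succ]
  rw [position_eq ω ξ t n h₁ h₂, add_sub_cancel_left, abs_mul, abs_of_nonneg (sub_nonneg.2 h₁)]
  exact (mul_le_of_le_one_left (sub_nonneg.2 h₁) hsign).trans (by linarith)

theorem abs_position_sub_le {ω : ℤ → ℝ} {ξ : ℕ → ℤ} {t : ℝ≥0} {a b : ℕ}
    (ha : collisionTime ω ξ a ≤ t) (hb : (t : ℝ) < collisionTime ω ξ b) {y r : ℝ}
    (hr : ∀ k, a ≤ k → k ≤ b → |ω (walk ξ k) - y| ≤ r) : |position ω ξ t - y| ≤ 3 * r := by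
  obtain ⟨n, han, hnb, h₁, h₂⟩ := exists_collisionTime_le_lt ha hb
  have hleft := hr n han hnb.le
  have hright := hr (n + 1) (by omega) hnb
  rw [abs_sub_comm] at hright
  have hjump := abs_position_sub_le_abs_jump h₁ h₂
  rw [abs_sub_comm (ω _)] at hjump
  linarith [abs_sub_le (position ω ξ t) (ω (walk ξ n)) y,
    abs_sub_le (ω (walk ξ n)) y (ω (walk ξ (n + 1)))]

theorem abs_position_sub_mul_walk_le {ω : ℤ → ℝ} {ξ : ℕ → ℤ} {t : ℝ≥0} {a N b : ℕ}
    (ha : collisionTime ω ξ a ≤ t) (hb : (t : ℝ) < collisionTime ω ξ b) (haN : a ≤ N) (hNb : N ≤ b)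
    {m η r K L : ℝ} (hm : 0 ≤ m) (hη : 0 ≤ η)
    (hosc : ∀ k, a ≤ k → k ≤ b → |(walk ξ k : ℝ) - walk ξ a| ≤ r)
    (hmax : ∀ k ≤ b, |(walk ξ k : ℝ)| ≤ K)
    (hω : ∀ x : ℤ, |ω x - m * x| ≤ η * (|(x : ℝ)| + L)) :
    |position ω ξ t - m * walk ξ N| ≤ 3 * (η * (K + L) + m * (2 * r)) := by
  refine abs_position_sub_le ha hb fun k hak hkb => ?_
  have htarget : |ω (walk ξ k) - m * walk ξ k| ≤ η * (K + L) := by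
    refine (hω _).trans ?_
    gcongr
    exact hmax k hkb
  have hwalk : |m * (walk ξ k : ℝ) - m * walk ξ N| ≤ m * (2 * r) := by
    rw [← mul_sub, abs_mul, abs_of_nonneg hm]
    gcongr
    have hN := hosc N haN hNb
    rw [abs_sub_comm] at hN
    linarith [abs_sub_le (walk ξ k : ℝ) (walk ξ a) (walk ξ N), hosc k hak hkb]
  linarith [abs_sub_le (ω (walk ξ k)) (m * walk ξ k) (m * walk ξ N)]

theorem measure_le_abs_position_sub_mul_walk_le {ν : Measure ℝ} [IsProbabilityMeasure ν]
    {p : PMF ℤ} {t : ℝ≥0} {a N b : ℕ} (haN : a ≤ N) (hNb : N ≤ b) {m η r K L ε : ℝ} (hm : 0 ≤ m)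
    (hη : 0 ≤ η) (hε : 3 * (η * (K + L) + m * (2 * r)) < ε) :
    jointLaw ν p {z | ε ≤ |position (targets z.1) z.2 t - m * walk z.2 N|} ≤
      jointLaw ν p {z | t < collisionTime (targets z.1) z.2 a} +
      jointLaw ν p {z | collisionTime (targets z.1) z.2 b ≤ t} +
      gapLaw ν {ζ | ∃ x : ℤ, η * (|(x : ℝ)| + L) < |targets ζ x - m * x|} +
      walkLaw p {ξ | ∃ k, a ≤ k ∧ k ≤ b ∧ r ≤ |(walk ξ k : ℝ) - walk ξ a|} +
      walkLaw p {ξ | ∃ k ≤ b, K ≤ |(walk ξ k : ℝ)|} := by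
  grw [← (measurePreserving_fst_jointLaw (p := p)).measure_preimage_le,
    ← (measurePreserving_snd_jointLaw (ν := ν)).measure_preimage_le,
    ← (measurePreserving_snd_jointLaw (ν := ν)).measure_preimage_le,
    ← measure_union_le, ← measure_union_le, ← measure_union_le, ← measure_union_le]
  refine measure_mono fun z hz => ?_
  by_contra hgood
  simp only [Set.mem_union, Set.mem_preimage, Set.mem_ofPred_eq, not_or, not_exists, not_and,
    not_lt, not_le] at hgood
  obtain ⟨⟨⟨⟨ha, hb⟩, htargets⟩, hosc⟩, hmax⟩ := hgood
  exact (hε.trans_le hz).not_ge (abs_position_sub_mul_walk_le ha hb haN hNb hm hη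
    (fun k hak hkb => (hosc k hak hkb).le) (fun k hk => (hmax k hk).le) htargets)

section Approximation

variable {ν : Measure ℝ} [IsProbabilityMeasure ν] {p : PMF ℤ}
  (hL : MemLp (fun k : ℤ => (k : ℝ)) 2 p.toMeasure) (h0 : ∫ k : ℤ, (k : ℝ) ∂p.toMeasure = 0)
include hL h0

theorem eventually_measure_exists_le_abs_walk_sub_le {c₁ c₂ r : ℝ} (hc₁ : 0 ≤ c₁) (hc : c₁ ≤ c₂)
    (hr : 0 < r) {δ : ℝ≥0∞} (hδ : ENNReal.ofReal ((c₂ - c₁) * jumpVariance p / r ^ 2) < δ) :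
    ∀ᶠ t : ℝ in atTop, walkLaw p {ξ | ∃ k, ⌈c₁ * t⌉₊ ≤ k ∧ k ≤ ⌈c₂ * t⌉₊ ∧
      r * √t ≤ |(walk ξ k : ℝ) - walk ξ ⌈c₁ * t⌉₊|} ≤ δ := by
  have hlim : Tendsto (fun t : ℝ => ENNReal.ofReal
      (((⌈c₂ * t⌉₊ : ℝ) / t - (⌈c₁ * t⌉₊ : ℝ) / t) * jumpVariance p / r ^ 2)) atTop
      (𝓝 (ENNReal.ofReal ((c₂ - c₁) * jumpVariance p / r ^ 2))) :=
    ENNReal.tendsto_ofReal ((((tendsto_nat_ceil_mul_div_atTop (hc₁.trans hc)).sub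
      (tendsto_nat_ceil_mul_div_atTop hc₁)).mul_const _).div_const _)
  filter_upwards [hlim.eventually_lt_const hδ, eventually_gt_atTop 0] with t ht ht0
  have hab : ⌈c₁ * t⌉₊ ≤ ⌈c₂ * t⌉₊ := Nat.ceil_mono (by gcongr)
  have hmax := measure_exists_le_abs_walk_sub_le hL h0 ⌈c₁ * t⌉₊ (⌈c₂ * t⌉₊ - ⌈c₁ * t⌉₊)
    (r := r * √t) (by positivity)
  rw [Nat.add_sub_cancel' hab, Nat.cast_sub hab, mul_pow, Real.sq_sqrt ht0.le] at hmax
  refine hmax.trans (le_of_eq_of_le ?_ ht.le)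
  congr 1
  field_simp

theorem exists_eventually_measure_walk_oscillation_le {c r : ℝ} (hc : 0 < c) (hr : 0 < r)
    {δ : ℝ≥0∞} (hδ : 0 < δ) :
    ∃ h, 0 < h ∧ h < c ∧ ∀ᶠ t : ℝ in atTop, walkLaw p {ξ | ∃ k, ⌈(c - h) * t⌉₊ ≤ k ∧
      k ≤ ⌈(c + h) * t⌉₊ ∧ r * √t ≤ |(walk ξ k : ℝ) - walk ξ ⌈(c - h) * t⌉₊|} ≤ δ := by
  have hlim : Tendsto (fun h : ℝ => ENNReal.ofReal
      ((c + h - (c - h)) * jumpVariance p / r ^ 2)) (𝓝[>] 0) (𝓝 0) := by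
    rw [← ENNReal.ofReal_zero]
    exact ENNReal.tendsto_ofReal
      ((Continuous.tendsto' (by fun_prop) 0 0 (by simp)).mono_left nhdsWithin_le_nhds)
  obtain ⟨h, hhδ, h_pos, hhc⟩ :=
    ((hlim.eventually_lt_const hδ).and (Ioo_mem_nhdsGT hc)).exists
  exact ⟨h, h_pos, hhc, eventually_measure_exists_le_abs_walk_sub_le hL h0 (by linarith)
    (by linarith) hr hhδ⟩

theorem exists_eventually_measure_walk_maximum_le {c : ℝ} (hc : 0 ≤ c) {δ : ℝ≥0∞} (hδ : 0 < δ) :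
    ∃ K, 0 < K ∧ ∀ᶠ t : ℝ in atTop,
      walkLaw p {ξ | ∃ k ≤ ⌈c * t⌉₊, K * √t ≤ |(walk ξ k : ℝ)|} ≤ δ := by
  have hlim : Tendsto (fun K : ℝ => ENNReal.ofReal ((c - 0) * jumpVariance p / K ^ 2)) atTop
      (𝓝 0) := by
    simpa using ENNReal.tendsto_ofReal
      ((tendsto_const_nhds (x := (c - 0) * jumpVariance p)).div_atTop
        (tendsto_pow_atTop two_ne_zero))
  obtain ⟨K, hKδ, hK⟩ := ((hlim.eventually_lt_const hδ).and (eventually_gt_atTop 0)).exists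
  refine ⟨K, hK, ?_⟩
  simpa [walk] using eventually_measure_exists_le_abs_walk_sub_le hL h0 le_rfl hc hK hKδ

variable (hν : ∀ᵐ x ∂ν, 0 ≤ x) (hν_int : Integrable (fun x : ℝ => x) ν) (hv : jumpVariance p ≠ 0)
include hν hν_int hv

theorem tendsto_measure_le_abs_collisionTime_div_sub {ε : ℝ} (hε : 0 < ε) :
    Tendsto (fun n : ℕ => jointLaw ν p {z | ε ≤ |collisionTime (targets z.1) z.2 n / n -
      (∫ x, x ∂ν) * meanAbsJump p|}) atTop (𝓝 0) := by
  have hmeas (n : ℕ) : AEStronglyMeasurable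
      (fun z => collisionTime (targets z.1) z.2 n / n) (jointLaw ν p) :=
    (((measurable_collisionTime n).comp (measurable_targets.prodMap measurable_id)).div_const
      (n : ℝ)).aestronglyMeasurable
  have hlim : TendstoInMeasure (jointLaw ν p)
      (fun (n : ℕ) z => collisionTime (targets z.1) z.2 n / n) atTop
      fun _ => (∫ x, x ∂ν) * meanAbsJump p :=
    tendstoInMeasure_of_tendsto_eLpNorm one_ne_zero hmeas aestronglyMeasurable_const
      (tendsto_eLpNorm_collisionTime_div_sub hL hν hν_int h0 hv)
  exact tendstoInMeasure_iff_norm.1 hlim ε hε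

theorem tendsto_measure_lt_collisionTime {c : ℝ} (hc : 0 < c)
    (hcκ : (∫ x, x ∂ν) * meanAbsJump p < c⁻¹) :
    Tendsto (fun t : ℝ => jointLaw ν p {z | t < collisionTime (targets z.1) z.2 ⌈c * t⌉₊}) atTop
      (𝓝 0) := by
  obtain ⟨s, hκs, hsc⟩ := exists_between hcκ
  refine tendsto_of_tendsto_of_tendsto_of_le_of_le' tendsto_const_nhds
    ((tendsto_measure_le_abs_collisionTime_div_sub hL h0 hν hν_int hv (sub_pos.2 hκs)).comp
      (tendsto_nat_ceil_atTop.comp (tendsto_id.const_mul_atTop hc)))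
    (Eventually.of_forall fun t => zero_le) ?_
  have hlim := (tendsto_nat_ceil_mul_div_atTop hc.le).inv₀ hc.ne'
  simp only [inv_div] at hlim
  filter_upwards [hlim.eventually_const_le hsc] with t ht
  refine measure_mono fun z (hz : t < _) => ?_
  have hdiv : t / ⌈c * t⌉₊ ≤ collisionTime (targets z.1) z.2 ⌈c * t⌉₊ / ⌈c * t⌉₊ := by gcongr
  exact (sub_le_sub_right (ht.trans hdiv) _).trans (le_abs_self _)

theorem tendsto_measure_collisionTime_le {c : ℝ} (hc : 0 < c)
    (hcκ : c⁻¹ < (∫ x, x ∂ν) * meanAbsJump p) :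
    Tendsto (fun t : ℝ => jointLaw ν p {z | collisionTime (targets z.1) z.2 ⌈c * t⌉₊ ≤ t}) atTop
      (𝓝 0) := by
  obtain ⟨s, hcs, hsκ⟩ := exists_between hcκ
  refine tendsto_of_tendsto_of_tendsto_of_le_of_le' tendsto_const_nhds
    ((tendsto_measure_le_abs_collisionTime_div_sub hL h0 hν hν_int hv (sub_pos.2 hsκ)).comp
      (tendsto_nat_ceil_atTop.comp (tendsto_id.const_mul_atTop hc)))
    (Eventually.of_forall fun t => zero_le) ?_
  have hlim := (tendsto_nat_ceil_mul_div_atTop hc.le).inv₀ hc.ne'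
  simp only [inv_div] at hlim
  filter_upwards [hlim.eventually_le_const hcs] with t ht
  refine measure_mono fun z (hz : _ ≤ t) => ?_
  have hdiv : collisionTime (targets z.1) z.2 ⌈c * t⌉₊ / ⌈c * t⌉₊ ≤ t / ⌈c * t⌉₊ := by gcongr
  exact (sub_le_sub_left (hdiv.trans ht) _).trans ((le_abs_self _).trans_eq (abs_sub_comm _ _))

theorem tendsto_measure_le_abs_position_sub_mul_walk (hm : 0 < ∫ x, x ∂ν) {ε : ℝ} (hε : 0 < ε) :
    Tendsto (fun t : ℝ≥0 => jointLaw ν p {z | ε * √t ≤ |position (targets z.1) z.2 t -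
      (∫ x, x ∂ν) * walk z.2 ⌈((∫ x, x ∂ν) * meanAbsJump p)⁻¹ * t⌉₊|}) atTop (𝓝 0) := by
  have hκ := mul_pos hm (meanAbsJump_pos hL hv)
  set m := ∫ x, x ∂ν
  set c := (m * meanAbsJump p)⁻¹
  have hc : 0 < c := inv_pos.2 hκ
  refine ENNReal.tendsto_nhds_zero.2 fun δ hδ => ?_
  have hδ3 : 0 < δ / 3 := by simpa using hδ.ne'
  obtain ⟨h, h_pos, hhc, hosc⟩ := exists_eventually_measure_walk_oscillation_le hL h0 hc
    (show 0 < ε / (24 * m) by positivity) hδ3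
  obtain ⟨K, hK, hmax⟩ := exists_eventually_measure_walk_maximum_le hL h0
    (show 0 ≤ c + h by positivity) hδ3
  have hc₁ : m * meanAbsJump p < (c - h)⁻¹ :=
    (lt_inv_comm₀ hκ (by linarith)).2 (sub_lt_self c h_pos)
  have hc₂ : (c + h)⁻¹ < m * meanAbsJump p :=
    (inv_lt_comm₀ (by linarith) hκ).2 (lt_add_of_pos_right c h_pos)
  have hrest := ((tendsto_measure_lt_collisionTime hL h0 hν hν_int hv (by linarith) hc₁).add
    (tendsto_measure_collisionTime_le hL h0 hν hν_int hv (by linarith) hc₂)).add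
    ((tendsto_measure_exists_lt_abs_targets_sub hν_int
      (show 0 < ε / (12 * (K + 1)) by positivity)).comp Real.tendsto_sqrt_atTop)
  rw [add_zero, add_zero] at hrest
  have hcoe : Tendsto (fun t : ℝ≥0 => (t : ℝ)) atTop atTop := NNReal.tendsto_coe_atTop.2 tendsto_id
  filter_upwards [hcoe.eventually hosc, hcoe.eventually hmax,
    hcoe.eventually (hrest.eventually_le_const hδ3), eventually_gt_atTop 0] with t ht₁ ht₂ ht₃ ht0
  have ht : 0 < √(t : ℝ) := Real.sqrt_pos.2 (NNReal.coe_pos.2 ht0)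
  have herr : 3 * (ε / (12 * (K + 1)) * (K * √t + √t) + m * (2 * (ε / (24 * m) * √t))) <
      ε * √t := by
    have : 3 * (ε / (12 * (K + 1)) * (K * √t + √t) + m * (2 * (ε / (24 * m) * √t))) =
        ε * √t / 2 := by
      field_simp
      ring
    linarith [mul_pos hε ht]
  refine (measure_le_abs_position_sub_mul_walk_le (Nat.ceil_mono ?_) (Nat.ceil_mono ?_) hm.le
    (by positivity) herr).trans (le_of_le_of_eq (add_le_add (add_le_add ht₃ ht₁) ht₂)
      (ENNReal.add_thirds δ))
  · gcongr; linarith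
  · gcongr; linarith

end Approximation

/-! ### The central limit theorem for the position -/

theorem tendstoInDistribution_comp_measurePreserving {ι κ Ω Ω₀ Ω' E : Type*}
    [MeasurableSpace Ω] {Q : Measure Ω} [IsProbabilityMeasure Q] [MeasurableSpace Ω₀]
    {P : Measure Ω₀} [IsProbabilityMeasure P] [MeasurableSpace Ω'] {P' : Measure Ω'}
    [IsProbabilityMeasure P'] [TopologicalSpace E] [MeasurableSpace E] [OpensMeasurableSpace E]
    {X : ι → Ω₀ → E} {Z : Ω' → E} {l : Filter ι} {l' : Filter κ}
    (h : TendstoInDistribution X l Z (fun _ => P) P') {f : Ω → Ω₀} (hf : MeasurePreserving f Q P)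
    {g : κ → ι} (hg : Tendsto g l' l) :
    TendstoInDistribution (fun i ω => X (g i) (f ω)) l' Z (fun _ => Q) P' where
  forall_aemeasurable i :=
    (h.forall_aemeasurable (g i)).comp_quasiMeasurePreserving hf.quasiMeasurePreserving
  aemeasurable_limit := h.aemeasurable_limit
  tendsto := by
    refine (h.tendsto.comp hg).congr fun i => Subtype.ext ?_
    have hX := h.forall_aemeasurable (g i)
    rw [← hf.map_eq] at hX
    change P.map (X (g i)) = Q.map (X (g i) ∘ f)
    rw [← AEMeasurable.map_map_of_aemeasurable hX hf.aemeasurable, hf.map_eq]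

theorem tendstoInMeasure_of_tendsto {ι Ω E : Type*} [MeasurableSpace Ω] {P : Measure Ω}
    [PseudoEMetricSpace E] {a : ι → E} {b : E} {l : Filter ι} (h : Tendsto a l (𝓝 b)) :
    TendstoInMeasure P (fun i _ => a i) l fun _ => b := fun ε hε => by
  refine tendsto_const_nhds.congr' ?_
  filter_upwards [(tendsto_iff_edist_tendsto_0.1 h).eventually_lt_const hε] with i hi
  simp [hi.not_ge]

theorem lintegral_ofReal_mul_sq_gaussianReal (a : ℝ) (v : ℝ≥0) :
    ∫⁻ x, ENNReal.ofReal ((a * x) ^ 2) ∂(gaussianReal 0 v) = ENNReal.ofReal (a ^ 2 * v) := by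
  have hL : MemLp (fun x => x) 2 (gaussianReal 0 v) := memLp_id_gaussianReal 2
  have hsq : ∫ x, x ^ 2 ∂(gaussianReal 0 v) = v := by
    rw [← variance_of_integral_eq_zero hL.aemeasurable integral_id_gaussianReal]
    exact variance_id_gaussianReal
  rw [← ofReal_integral_eq_lintegral_ofReal (hL.const_mul a).integrable_sq
    (ae_of_all _ fun x => sq_nonneg _)]
  simp only [mul_pow]
  rw [integral_const_mul, hsq]

theorem integral_pos_of_ae_pos {ν : Measure ℝ} [NeZero ν] (hν_pos : ∀ᵐ x ∂ν, 0 < x)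
    (hν_int : Integrable (fun x : ℝ => x) ν) : 0 < ∫ x, x ∂ν := by
  refine (integral_nonneg_of_ae (hν_pos.mono fun x hx => hx.le)).lt_of_ne' fun h => ?_
  rw [integral_eq_zero_iff_of_nonneg_ae (hν_pos.mono fun x hx => hx.le) hν_int] at h
  obtain ⟨x, hx, hx0⟩ := (hν_pos.and h).exists
  exact hx.ne' hx0

section Conclusion

variable {ν : Measure ℝ} [IsProbabilityMeasure ν] {p : PMF ℤ}

theorem lintegral_annealedLaw_fst {F : (ℝ≥0 → ℝ) → ℝ≥0∞} (hF : Measurable F) :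
    ∫⁻ z, F z.1 ∂(annealedLaw ν p) =
      ∫⁻ z, F (position (targets z.1) z.2) ∂(jointLaw ν p) := by
  have hpos : Measurable fun x : (ℤ → ℝ) × (ℕ → ℤ) => F (position x.1 x.2) :=
    hF.comp measurable_position
  have hquenched (ω : ℤ → ℝ) :
      ∫⁻ f, F f ∂(quenchedLaw p ω) = ∫⁻ ξ, F (position ω ξ) ∂(walkLaw p) :=
    lintegral_map hF (measurable_position.comp measurable_prodMk_left)
  rw [annealedLaw, lintegral_map (f := fun z : (ℝ≥0 → ℝ) × (ℤ → ℝ) => F z.1)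
    (hF.comp measurable_fst) measurable_swap]
  simp only [Prod.fst_swap]
  rw [Measure.lintegral_compProd (f := fun z => F z.2) (hF.comp measurable_snd)]
  simp only [hquenched]
  rw [envLaw, lintegral_map hpos.lintegral_prod_right' measurable_targets]
  exact (lintegral_prod _
    (hpos.comp (measurable_targets.prodMap measurable_id)).aemeasurable).symm

variable (hL : MemLp (fun k : ℤ => (k : ℝ)) 2 p.toMeasure) (h0 : ∫ k : ℤ, (k : ℝ) ∂p.toMeasure = 0)
include hL h0

theorem tendstoInDistribution_inv_sqrt_mul_walk :
    TendstoInDistribution (fun (n : ℕ) ξ => (√n)⁻¹ * walk ξ n) atTop id (fun _ => walkLaw p)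
      (gaussianReal 0 (jumpVariance p).toNNReal) := by
  have hident := identDistrib_comp_jump p fun k : ℤ => (k : ℝ)
  have hvar : Var[fun ξ : ℕ → ℤ => (ξ 0 : ℝ); walkLaw p] = jumpVariance p :=
    (hident 0).variance_eq
  have hmean : ∫ ξ, (ξ 0 : ℝ) ∂(walkLaw p) = 0 := (hident 0).integral_eq.trans h0
  simpa [hmean, walk_cast] using tendstoInDistribution_inv_sqrt_mul_sum_sub
    (X := fun i (ξ : ℕ → ℤ) => (ξ i : ℝ)) (P' := gaussianReal 0 (jumpVariance p).toNNReal) (Y := id)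
    (by rw [hvar]; exact HasLaw.id) (memLp_jump_apply hL 0) (iIndepFun_comp_jump p _)
    fun i => (hident i).trans (hident 0).symm

theorem tendstoInDistribution_mul_walk_div_sqrt (m : ℝ) {c : ℝ} (hc : 0 < c) :
    TendstoInDistribution (fun (t : ℝ≥0) (z : (ℤ → ℝ) × (ℕ → ℤ)) => m * walk z.2 ⌈c * t⌉₊ / √t)
      atTop (fun x => m * √c * x) (fun _ => jointLaw ν p)
      (gaussianReal 0 (jumpVariance p).toNNReal) := by
  have hcoe : Tendsto (fun t : ℝ≥0 => (t : ℝ)) atTop atTop := NNReal.tendsto_coe_atTop.2 tendsto_id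
  have hclt := tendstoInDistribution_comp_measurePreserving
    (tendstoInDistribution_inv_sqrt_mul_walk hL h0) (measurePreserving_snd_jointLaw (ν := ν))
    (tendsto_nat_ceil_atTop.comp (hcoe.const_mul_atTop hc))
  have hscale : Tendsto (fun t : ℝ≥0 => m * √((⌈c * t⌉₊ : ℝ) / t)) atTop (𝓝 (m * √c)) :=
    ((tendsto_nat_ceil_mul_div_atTop hc.le).comp hcoe).sqrt.const_mul m
  have hslutsky := hclt.continuous_comp_prodMk_of_tendstoInMeasure_const
    (g := fun x : ℝ × ℝ => x.2 * x.1) (by fun_prop)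
    (tendstoInMeasure_of_tendsto hscale) fun t => aemeasurable_const
  refine hslutsky.congr (fun t => ae_of_all _ fun z => ?_) (ae_of_all _ fun x => rfl)
  rcases eq_zero_or_pos t with rfl | ht
  · simp [walk]
  · have hN : (0 : ℝ) < ⌈c * t⌉₊ := Nat.cast_pos.2 (Nat.ceil_pos.2 (by positivity))
    change m * √((⌈c * t⌉₊ : ℝ) / t) * ((√⌈c * t⌉₊)⁻¹ * walk z.2 ⌈c * t⌉₊) = _
    rw [Real.sqrt_div hN.le]
    field_simp

variable (hν : ∀ᵐ x ∂ν, 0 ≤ x) (hν_int : Integrable (fun x : ℝ => x) ν) (hv : jumpVariance p ≠ 0)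
include hν hν_int hv

theorem tendstoInDistribution_position_div_sqrt (hm : 0 < ∫ x, x ∂ν) :
    TendstoInDistribution
      (fun (t : ℝ≥0) (z : (ℤ → ℝ) × (ℕ → ℤ)) => position (targets z.1) z.2 t / √t)
      atTop (fun x => √((∫ x, x ∂ν) / meanAbsJump p) * x) (fun _ => jointLaw ν p)
      (gaussianReal 0 (jumpVariance p).toNNReal) := by
  have hm' := meanAbsJump_pos hL hv
  have hκ := mul_pos hm hm'
  have hscale : √((∫ x, x ∂ν) / meanAbsJump p) =
      (∫ x, x ∂ν) * √((∫ x, x ∂ν) * meanAbsJump p)⁻¹ := by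
    rw [Real.sqrt_eq_iff_mul_self_eq (by positivity) (by positivity), mul_mul_mul_comm,
      Real.mul_self_sqrt (by positivity)]
    field_simp
  rw [hscale]
  refine tendstoInDistribution_of_tendstoInMeasure_sub _ _
    (tendstoInDistribution_mul_walk_div_sqrt hL h0 _ (inv_pos.2 hκ)) ?_ fun t => ?_
  · refine tendstoInMeasure_iff_norm.2 fun ε hε => ?_
    refine tendsto_of_tendsto_of_tendsto_of_le_of_le' tendsto_const_nhds
      (tendsto_measure_le_abs_position_sub_mul_walk hL h0 hν hν_int hv hm hε)
      (Eventually.of_forall fun t => zero_le) ?_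
    filter_upwards [eventually_gt_atTop 0] with t ht
    refine measure_mono fun z hz => ?_
    have hsqrt : 0 < √(t : ℝ) := Real.sqrt_pos.2 (NNReal.coe_pos.2 ht)
    simp only [Set.mem_ofPred_eq, Pi.sub_apply, Pi.zero_apply, sub_zero, ← sub_div, norm_div,
      Real.norm_eq_abs, abs_of_pos hsqrt] at hz
    exact (le_div_iff₀ hsqrt).1 hz
  · exact (((measurable_pi_apply t).comp (measurable_position.comp
      (measurable_targets.prodMap measurable_id))).div_const _).aemeasurable

theorem ofReal_mul_jumpVariance_le_liminf (hm : 0 < ∫ x, x ∂ν) :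
    ENNReal.ofReal ((∫ x, x ∂ν) / meanAbsJump p * jumpVariance p) ≤
      liminf (fun t : ℝ≥0 =>
        (∫⁻ z, ENNReal.ofReal (z.1 t ^ 2) ∂(annealedLaw ν p)) / (t : ℝ≥0∞)) atTop := by
  have hm' := meanAbsJump_pos hL hv
  have hfatou : ∫⁻ x, ENNReal.ofReal ((√((∫ x, x ∂ν) / meanAbsJump p) * x) ^ 2)
      ∂(gaussianReal 0 (jumpVariance p).toNNReal) ≤ liminf (fun t : ℝ≥0 =>
        ∫⁻ z, ENNReal.ofReal ((position (targets z.1) z.2 t / √t) ^ 2) ∂(jointLaw ν p)) atTop :=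
    lintegral_le_liminf_of_tendstoInDistribution (f := fun x : ℝ => (x ^ 2).toNNReal)
      (by fun_prop) (tendstoInDistribution_position_div_sqrt hL h0 hν hν_int hv hm)
  rw [lintegral_ofReal_mul_sq_gaussianReal, Real.sq_sqrt (by positivity),
    Real.coe_toNNReal (jumpVariance p) (variance_nonneg _ _)] at hfatou
  refine hfatou.trans_eq (liminf_congr ?_)
  filter_upwards [eventually_gt_atTop 0] with t ht
  rw [lintegral_annealedLaw_fst ((measurable_pi_apply t).pow_const 2).ennreal_ofReal]
  rw [ENNReal.div_eq_inv_mul, ← lintegral_const_mul' _ _ (by simpa using ht.ne')]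
  refine lintegral_congr fun z => ?_
  rw [div_pow, Real.sq_sqrt t.coe_nonneg, ENNReal.ofReal_div_of_pos (NNReal.coe_pos.2 ht),
    ENNReal.div_eq_inv_mul, ENNReal.ofReal_coe_nnreal]

end Conclusion

end LevyEnv

open LevyEnv in
theorem mainTheorem4_general
    (ν : Measure ℝ) [IsProbabilityMeasure ν]
    (hν : ∀ᵐ x ∂ν, 0 ≤ x) (hν_int : Integrable (fun x : ℝ => x) ν) (hν_mean : 0 < ∫ x, x ∂ν)
    (p : PMF ℤ)
    (hp_mean : ∑' k : ℤ, (k : ℝ) * (p k).toReal = 0)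
    (hp_var : Summable fun k : ℤ => (k : ℝ) ^ 2 * (p k).toReal)
    (hp_var_pos : 0 < ∑' k : ℤ, (k : ℝ) ^ 2 * (p k).toReal) :
    Tendsto (scaledMoment p 2) atTop (𝓝 (limitMoment p 2)) ∧
    ENNReal.ofReal ((∫ x, x ∂ν) / meanAbsJump p) * limitMoment p 2 ≤
      liminf (fun t : ℝ≥0 =>
        (∫⁻ z, ENNReal.ofReal ((z.1 t) ^ 2) ∂(annealedLaw ν p)) / (t : ℝ≥0∞)) atTop := by
  have hL := memLp_jump hp_var
  have h0 := (integral_jump_eq_tsum hL).trans hp_mean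
  have hv : jumpVariance p ≠ 0 := (jumpVariance_eq_tsum hL h0).trans_ne hp_var_pos.ne'
  have hm' := meanAbsJump_pos hL hv
  rw [limitMoment_two hL h0, ← ENNReal.ofReal_mul (by positivity)]
  exact ⟨tendsto_scaledMoment_two hL h0,
    ofReal_mul_jumpVariance_le_liminf hL h0 hν hν_int hv hν_mean⟩

theorem mainTheorem4
    (ν : Measure ℝ) [IsProbabilityMeasure ν]
    (hν_pos : ∀ᵐ x ∂ν, 0 < x) (hν_int : Integrable (fun x : ℝ => x) ν)
    (p : PMF ℤ)
    (hp_symm : ∀ k : ℤ, p (-k) = p k)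
    (hp_mono : ∀ k : ℤ, 1 ≤ k → p (k + 1) ≤ p k)
    (hp_var : Summable fun k : ℤ => (k : ℝ) ^ 2 * (p k).toReal)
    (hp_var_pos : 0 < ∑' k : ℤ, (k : ℝ) ^ 2 * (p k).toReal) :
    Tendsto (LevyEnv.scaledMoment p 2) atTop (𝓝 (LevyEnv.limitMoment p 2)) ∧
    ENNReal.ofReal ((∫ x, x ∂ν) / LevyEnv.meanAbsJump p) * LevyEnv.limitMoment p 2 ≤
      liminf (fun t : ℝ≥0 =>
        (∫⁻ z, ENNReal.ofReal ((z.1 t) ^ 2) ∂(LevyEnv.annealedLaw ν p)) / (t : ℝ≥0∞)) atTop :=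
  mainTheorem4_general ν (hν_pos.mono fun _ hx => hx.le) hν_int
    (LevyEnv.integral_pos_of_ae_pos hν_pos hν_int) p
    (LevyEnv.tsum_mul_apply_eq_zero_of_symm hp_symm) hp_var hp_var_pos
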